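/- **Setting.** For a finite family of subsets of $[n]$, let $opt$ be the least number of its members whose union is $[n]$ ($opt=\infty$ if there is no cover). In the problem $\mathsf{SetCover}_{est}$ with parameters $n,m,\alpha$, Alice holds sets $\mathcal S=(S_1,\dots,S_m)$, Bob holds a set $T$ (all subsets of $[n]$), and Bob must output a value in $[opt,\alpha\cdot opt]$, where $opt=opt(S_1,\dots,S_m,T)$. In a one-way protocol, Alice sends Bob a single bit string, and Bob then answers; both use public and private randomness. For a distribution $\mathcal D$ on inputs, a $\delta$-error protocol is one whose answer is wrong with probability at most $\delta$ (over $\mathcal D$ and the randomness of the protocol). $CC^{\delta}_{\mathcal D}$ is the minimum, over all $\delta$-error protocols, of the worst-case number of bits sent on inputs in the support of $\mathcal D$. The distribution $\mathcal D_{est}$ is as follows. $S_1,\dots,S_m$ are independent uniformly random subsets of $[n]$ of size $\frac{n}{10\alpha}$; $\theta\in\{0,1\}$ and $i^*\in[m]$ are uniform and independent of each other and of $\mathcal S$; $\bar T$ is a uniformly random set of size $\alpha\log_2 m$ contained in $S_{i^*}$ if $\theta=0$, and in $[n]\setminus S_{i^*}$ if $\theta=1$; and $T=[n]\setminus\bar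 T$. Each of the two sizes $\frac n{10\alpha}$ and $\alpha\log_2 m$ is replaced by any integer at distance less than $1$ from it. **Theorem.** For every constant $\delta<1/2$ and every $C\in\mathbb N$ there are $c>0$ and $k\in\mathbb N$ such that the following holds. Let $\alpha=\alpha(n)\ge 1$ be real numbers with $\alpha=o(\sqrt{n/\log n})$ and let $m=m(n)$ be integers with $m\to\infty$ and $m\le n^{C}$ for all large $n$. Then for all sufficiently large $n$ the distribution $\mathcal D_{est}$ is well defined and $$CC^{\delta}_{\mathcal D_{est}}(\mathsf{SetCover}_{est})\ \ge\ \frac{c}{(\log n)^{k}}\cdot\frac{mn}{\alpha^{2}},$$ that is, it is $\widetilde\Omega(mn/\alpha^2)$. The same lower bound holds even if Bob is additionally given the index $i^*$. -/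

import Mathlib

open Filter Asymptotics MeasureTheory
open scoped ENNReal

/-- The set cover size `opt` of a finite family `F` of subsets of a finite universe: the least number
of sets of the family whose union is the whole universe, and `⊤` if no subfamily covers it. -/
noncomputable def setCoverSize {ι U : Type} (F : ι → Finset U) : ℕ∞ :=
  ⨅ (I : Finset ι) (_ : ∀ u : U, ∃ i ∈ I, u ∈ F i), (I.card : ℕ∞)

/-- A one-way two-player protocol with inputs in `X` (Alice) and `Y` (Bob) and answers in `Z`.
The public randomness and the private randomness of either player are independent and live on
arbitrary probability spaces.  Alice sends one bit string, which depends on her input, the public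
randomness and her private randomness; Bob's answer depends on this string, his input, the public
randomness and his private randomness. -/
structure OneWayProtocol (X Y Z : Type) [MeasurableSpace Z] where
  Pub : Type
  PrivA : Type
  PrivB : Type
  [measurablePub : MeasurableSpace Pub]
  [measurablePrivA : MeasurableSpace PrivA]
  [measurablePrivB : MeasurableSpace PrivB]
  lawPub : Measure Pub
  lawA : Measure PrivA
  lawB : Measure PrivB
  [probPub : IsProbabilityMeasure lawPub]
  [probA : IsProbabilityMeasure lawA]
  [probB : IsProbabilityMeasure lawB]
  msg : X → Pub → PrivA → List Bool
  out : List Bool → Y → Pub → PrivB → Z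
  measurable_msg : ∀ (x : X) (w : List Bool),
    MeasurableSet {ω : Pub × PrivA | msg x ω.1 ω.2 = w}
  measurable_out : ∀ (w : List Bool) (y : Y),
    Measurable (fun ω : Pub × PrivB => out w y ω.1 ω.2)

namespace OneWayProtocol

variable {X Y Z : Type} [MeasurableSpace Z]

attribute [instance] measurablePub measurablePrivA measurablePrivB probPub probA probB

/-- The probability, over the input distribution `D` and all the randomness of the protocol, that
Bob's answer `z` on the input `(x, y)` violates the relation `P x y z`. -/
noncomputable def error (π : OneWayProtocol X Y Z) (P : X → Y → Z → Prop) (D : PMF (X × Y)) :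
    ℝ≥0∞ :=
  ∑' xy : X × Y, D xy *
    (π.lawPub.prod (π.lawA.prod π.lawB))
      {ω | ¬ P xy.1 xy.2 (π.out (π.msg xy.1 ω.1 ω.2.1) xy.2 ω.1 ω.2.2)}

/-- The communication cost: the worst-case number of bits that Alice sends on inputs from `D`. -/
noncomputable def cost (π : OneWayProtocol X Y Z) (D : PMF (X × Y)) : ℕ∞ :=
  ⨆ (x : X) (_ : ∃ y : Y, (x, y) ∈ D.support) (r : π.Pub) (a : π.PrivA),
    ((π.msg x r a).length : ℕ∞)

end OneWayProtocol

/-- The one-way communication complexity of the relation `P` with respect to the input distribution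
`D`: the least communication cost of a protocol whose error probability over `D` is at most `δ`. -/
noncomputable def commComplexity {X Y Z : Type} [MeasurableSpace Z]
    (P : X → Y → Z → Prop) (D : PMF (X × Y)) (δ : ℝ) : ℕ∞ :=
  ⨅ (π : OneWayProtocol X Y Z) (_ : π.error P D ≤ ENNReal.ofReal δ), π.cost D

/-- The problem of `α`-estimating set cover on `m + 1` subsets of `[n]`, where Alice holds
`S 0, …, S (m - 1)` and Bob holds `T`: the answer must lie in `[opt, α * opt]`.
On an instance without a set cover, `opt = ∞` and the only correct answer is `∞`. -/
def SetCoverEst (n m : ℕ) (α : ℝ) (S : Fin m → Finset (Fin n)) (T : Finset (Fin n))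
    (z : ℝ≥0∞) : Prop :=
  z ∈ Set.Icc ((setCoverSize (fun j : Option (Fin m) => j.elim T S) : ℕ∞) : ℝ≥0∞)
    (ENNReal.ofReal α * ((setCoverSize (fun j : Option (Fin m) => j.elim T S) : ℕ∞) : ℝ≥0∞))

/-- The same problem when Bob additionally knows an index. -/
def SetCoverEstIdx (n m : ℕ) (α : ℝ) (S : Fin m → Finset (Fin n)) (Ti : Finset (Fin n) × Fin m)
    (z : ℝ≥0∞) : Prop :=
  SetCoverEst n m α S Ti.1 z

/-- The conditions under which the hard distribution makes sense: an index can be drawn, and a set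
of size `p` can be drawn both inside and outside a set of size `s` of `[n]`. -/
structure EstParams (n m s p : ℕ) : Prop where
  m_pos : 0 < m
  p_le : p ≤ s
  add_le : s + p ≤ n

/-- The subsets of `[n]` of size `s`. -/
abbrev SizedSet (n s : ℕ) : Type := {A : Finset (Fin n) // A.card = s}

theorem SizedSet.nonempty {n s : ℕ} (h : s ≤ n) : Nonempty (SizedSet n s) := by
  obtain ⟨A, -, hA⟩ := Finset.exists_subset_card_eq
    (s := (Finset.univ : Finset (Fin n))) (n := s) (by simpa using h)
  exact ⟨⟨A, hA⟩⟩

theorem EstParams.block_nonempty {n m s p : ℕ} (h : EstParams n m s p) (A : SizedSet n s)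
    (θ : Bool) : (Finset.powersetCard p (if θ then A.1ᶜ else A.1)).Nonempty := by
  apply Finset.powersetCard_nonempty.2
  have h1 := h.p_le
  have h2 := h.add_le
  cases θ
  · simp [A.2, h1]
  · simp only [if_true, Finset.card_compl, A.2, Fintype.card_fin]
    omega

/-- The hard distribution, with the special index revealed to Bob.  Alice's sets `S 0, …, S (m - 1)`
are independent uniform `s`-subsets of `[n]` (that is, the tuple is uniform); `i` is a uniform index
and `θ` a uniform bit, independent of the rest; `E` is a uniform `p`-subset of `S i` if `θ = 0` and
of `[n] \ S i` if `θ = 1`; Bob receives the set `T = [n] \ E` and the index `i`. -/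
noncomputable def distEstIdx (n m s p : ℕ) (h : EstParams n m s p) :
    PMF ((Fin m → Finset (Fin n)) × (Finset (Fin n) × Fin m)) :=
  haveI : Nonempty (SizedSet n s) := SizedSet.nonempty (le_trans (Nat.le_add_right s p) h.add_le)
  haveI : Nonempty (Fin m) := ⟨⟨0, h.m_pos⟩⟩
  (PMF.uniformOfFintype (Fin m → SizedSet n s)).bind fun S =>
  (PMF.uniformOfFintype (Fin m)).bind fun i =>
  (PMF.uniformOfFintype Bool).bind fun θ =>
  (PMF.uniformOfFinset (Finset.powersetCard p (if θ then (S i).1ᶜ else (S i).1))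
    (h.block_nonempty (S i) θ)).map fun E => (fun j => (S j).1, (Eᶜ, i))

/-- The hard distribution itself, where Bob receives only the set `T`. -/
noncomputable def distEst (n m s p : ℕ) (h : EstParams n m s p) :
    PMF ((Fin m → Finset (Fin n)) × Finset (Fin n)) :=
  (distEstIdx n m s p h).map fun z => (z.1, z.2.1)

/-! Alice's sets hide about mn/α² bits, up to a logarithm, and a correct answer essentially reveals
a random one of them. Write E for Bob's block, the complement of T. If θ = 0, then T and S_{i*}
cover [n], so opt ≤ 2 and a correct answer is at most 2α. If θ = 1, a correct answer of at most 2α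
would force E to be covered by ⌊2α⌋ of the S_j. For a fixed E, a union bound gives this probability
at most m^{2α} (2αs/n)^p = O((8/9)^{log₂ m}), which tends to 0 (`card_coveredBy_le`,
`SizeBounds.cover_le`). Hence comparing the answer with 2α is a test for θ.

To exhibit the hidden bits, let q = ⌊s/p⌋ and let each S_j consist of one block from each of q pairs
of disjoint p-blocks, selected by bits, and a fixed filler (`exists_blocks`). The selected block
lies inside S_j, its partner outside. Independent random permutations, one for each j, turn such a
tuple and a block into an exact sample of the hard distribution for the corresponding θ, by
transitivity (`sum_perm_eq_blockMean`). Distinguishing the two values of θ is thus predicting one of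
mq independent bits, even if i* and the permutations are known.

A message with values in a small set M cannot help with most bits. For a fixed message the tests are
fixed and their total correlation with the bits is subgaussian; summing exponential moments over M
bounds the mean correlation by log|M|/l + l·mq/2 for every l > 0 (`sum_correlation_le`). A constant
advantage therefore needs log|M| of order mq, and q is at least of order n/(α² log m). Randomized
protocols reduce to deterministic ones by averaging over the randomness. -/

/-! ### Expectations under finite uniform distributions -/

theorem PMF.tsum_bind_mul {A B : Type*} (p : PMF A) (f : A → PMF B) (F : B → ℝ≥0∞) :
    ∑' b, (p.bind f) b * F b = ∑' a, p a * ∑' b, f a b * F b := by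
  simp only [PMF.bind_apply, ← ENNReal.tsum_mul_right, ← ENNReal.tsum_mul_left]
  rw [ENNReal.tsum_comm]
  simp only [mul_assoc]

theorem PMF.tsum_map_mul {A B : Type*} (p : PMF A) (g : A → B) (F : B → ℝ≥0∞) :
    ∑' b, (p.map g) b * F b = ∑' a, p a * F (g a) := by
  classical
  rw [PMF.map, PMF.tsum_bind_mul]
  refine tsum_congr fun a => ?_
  congr 1
  rw [tsum_eq_single (g a)]
  · simp
  · intro b hb
    simp [PMF.pure_apply, hb]

theorem PMF.tsum_uniformOfFinset_mul {A : Type*} (s : Finset A) (hs : s.Nonempty) (G : A → ℝ)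
    (hG : ∀ a, 0 ≤ G a) :
    ∑' a, PMF.uniformOfFinset s hs a * ENNReal.ofReal (G a) =
      ENNReal.ofReal ((s.card : ℝ)⁻¹ * ∑ a ∈ s, G a) := by
  classical
  rw [tsum_eq_sum (s := s)]
  · rw [ENNReal.ofReal_mul (by positivity), ENNReal.ofReal_sum_of_nonneg fun a _ => hG a,
      Finset.mul_sum, ENNReal.ofReal_inv_of_pos (by exact_mod_cast hs.card_pos)]
    refine Finset.sum_congr rfl fun a ha => ?_
    simp [PMF.uniformOfFinset_apply, ha]
  · intro a ha
    simp [PMF.uniformOfFinset_apply, ha]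

theorem PMF.tsum_uniformOfFintype_mul {A : Type*} [Fintype A] [Nonempty A] (G : A → ℝ)
    (hG : ∀ a, 0 ≤ G a) :
    ∑' a, PMF.uniformOfFintype A a * ENNReal.ofReal (G a) =
      ENNReal.ofReal ((Fintype.card A : ℝ)⁻¹ * ∑ a, G a) :=
  PMF.tsum_uniformOfFinset_mul Finset.univ Finset.univ_nonempty G hG

/-! ### Correlation of a short message with independent bits -/

/-- The sign of a bit. -/
def bitSign (b : Bool) : ℝ := if b then 1 else -1

theorem sum_exp_sign {ι : Type*} [Fintype ι] [DecidableEq ι] (c : ι → ℝ) :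
    ∑ x : ι → Bool, Real.exp (∑ i, c i * bitSign (x i)) = ∏ i, (2 * Real.cosh (c i)) := by
  simp only [Real.exp_sum]
  rw [← Fintype.piFinset_univ,
    ← Finset.prod_univ_sum (fun _ => Finset.univ) fun i b => Real.exp (c i * bitSign b)]
  refine Finset.prod_congr rfl fun i _ => ?_
  simp only [bitSign, Real.cosh_eq, Fintype.univ_bool, Finset.sum_insert, Finset.mem_singleton,
    Finset.sum_singleton, reduceCtorEq, not_false_eq_true, if_true, Bool.false_eq_true, if_false,
    mul_one, mul_neg]
  ring

/-- Independence factors the sum into hyperbolic cosines, and cosh t ≤ exp(t²/2): the subgaussian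
bound behind Hoeffding's inequality. -/
theorem sum_exp_sign_le {ι : Type*} [Fintype ι] [DecidableEq ι] (c : ι → ℝ) (l : ℝ)
    (hc : ∀ i, |c i| ≤ 1) :
    ∑ x : ι → Bool, Real.exp (l * ∑ i, c i * bitSign (x i)) ≤
      2 ^ Fintype.card ι * Real.exp (l ^ 2 * Fintype.card ι / 2) := by
  have h := sum_exp_sign fun i => l * c i
  simp only [mul_assoc, ← Finset.mul_sum] at h
  rw [h]
  have h1 : ∏ i : ι, Real.cosh (l * c i) ≤ ∏ _i : ι, Real.exp (l ^ 2 / 2) := by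
    refine Finset.prod_le_prod (fun i _ => (Real.cosh_pos _).le) fun i _ => ?_
    refine (Real.cosh_le_exp_half_sq _).trans (Real.exp_le_exp.2 ?_)
    have h2 : c i ^ 2 ≤ 1 := (sq_le_one_iff_abs_le_one _).2 (hc i)
    nlinarith [sq_nonneg l]
  rw [Finset.prod_mul_distrib]
  simp only [Finset.prod_const, Finset.card_univ, ← Real.exp_nat_mul] at h1 ⊢
  gcongr
  refine h1.trans_eq ?_
  congr 1
  ring

/-- A message with few possible values is correlated with only few of the independent bits on which
it depends. -/
theorem sum_correlation_le {ι W : Type*} [Fintype ι] [DecidableEq ι] (M : Finset W)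
    (f : (ι → Bool) → W) (hf : ∀ x, f x ∈ M) (c : W → ι → ℝ) (hc : ∀ w i, |c w i| ≤ 1)
    (l : ℝ) (hl : 0 < l) :
    ∑ x : ι → Bool, ∑ i, c (f x) i * bitSign (x i) ≤
      2 ^ Fintype.card ι * (Real.log M.card / l + l * Fintype.card ι / 2) := by
  have hM : (0 : ℝ) < M.card := by
    exact_mod_cast Finset.card_pos.2 ⟨_, hf fun _ => true⟩
  set N : ℝ := (Fintype.card ι : ℝ) with hN
  set B : ℝ := Real.log M.card + l ^ 2 * N / 2 with hB
  have h1 : ∑ x : ι → Bool, Real.exp (l * ∑ i, c (f x) i * bitSign (x i)) ≤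
      2 ^ Fintype.card ι * Real.exp B := by
    -- The coefficients depend on x through the message; bounding by the sum over all messages
    -- decouples them.
    calc _ ≤ ∑ x : ι → Bool, ∑ w ∈ M, Real.exp (l * ∑ i, c w i * bitSign (x i)) :=
          Finset.sum_le_sum fun x _ => Finset.single_le_sum
            (f := fun w => Real.exp (l * ∑ i, c w i * bitSign (x i)))
            (fun w _ => (Real.exp_pos _).le) (hf x)
      _ = ∑ w ∈ M, ∑ x : ι → Bool, Real.exp (l * ∑ i, c w i * bitSign (x i)) :=
          Finset.sum_comm
      _ ≤ ∑ _w ∈ M, 2 ^ Fintype.card ι * Real.exp (l ^ 2 * N / 2) :=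
          Finset.sum_le_sum fun w _ => sum_exp_sign_le _ _ (hc w)
      _ = _ := by
          rw [Finset.sum_const, nsmul_eq_mul, hB, Real.exp_add, Real.exp_log hM]
          ring
  -- The tangent inequality y + 1 ≤ exp y at y = (exponent) − B plays the role of Jensen's
  -- inequality.
  have h2 : ∀ x : ι → Bool, l * ∑ i, c (f x) i * bitSign (x i) ≤
      (B - 1) + Real.exp (-B) * Real.exp (l * ∑ i, c (f x) i * bitSign (x i)) := fun x => by
    rw [← Real.exp_add]
    linarith [Real.add_one_le_exp (-B + l * ∑ i, c (f x) i * bitSign (x i))]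
  have h3 := Finset.sum_le_sum fun (x : ι → Bool) (_ : x ∈ Finset.univ) => h2 x
  rw [← Finset.mul_sum, Finset.sum_add_distrib, ← Finset.mul_sum, Finset.sum_const,
    nsmul_eq_mul] at h3
  have h4 := mul_le_mul_of_nonneg_left h1 (Real.exp_pos (-B)).le
  have h5 : Real.exp (-B) * (2 ^ Fintype.card ι * Real.exp B) = 2 ^ Fintype.card ι := by
    rw [mul_left_comm, ← Real.exp_add]
    simp
  have h6 : ((Finset.univ : Finset (ι → Bool)).card : ℝ) = 2 ^ Fintype.card ι := by simp
  rw [h6] at h3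
  have h7 : l * ∑ x : ι → Bool, ∑ i, c (f x) i * bitSign (x i) ≤ 2 ^ Fintype.card ι * B := by
    linarith
  have h8 : Real.log M.card / l + l * N / 2 = B / l := by
    rw [hB]
    field_simp
  rw [h8, ← mul_div_assoc, le_div_iff₀ hl]
  linarith

/-! ### Symmetrization by permutations -/

/-- Averaging over a group equals averaging over an orbit. -/
theorem card_mul_sum_orbit {G Z : Type*} [Group G] [Fintype G] (Y : Finset Z) (act : G → Z → Z)
    (hone : ∀ z, act 1 z = z) (hmul : ∀ g h z, act (g * h) z = act g (act h z))
    (hmem : ∀ g, ∀ z ∈ Y, act g z ∈ Y) (htrans : ∀ y ∈ Y, ∀ z ∈ Y, ∃ g, act g y = z)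
    (F : Z → ℝ) {y : Z} (hy : y ∈ Y) :
    Y.card * ∑ g, F (act g y) = Fintype.card G * ∑ z ∈ Y, F z := by
  -- Double counting of pairs (z, g): by transitivity and right translation the inner sum over g is
  -- the same for every z, while in `h2` each fixed g permutes `Y`.
  have h1 : ∑ z ∈ Y, ∑ g, F (act g z) = Y.card * ∑ g, F (act g y) := by
    rw [← nsmul_eq_mul, ← Finset.sum_const]
    refine Finset.sum_congr rfl fun z hz => ?_
    obtain ⟨h, rfl⟩ := htrans y hy z hz
    simp only [← hmul]
    exact Equiv.sum_comp (Equiv.mulRight h) fun g => F (act g y)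
  have h2 : ∑ z ∈ Y, ∑ g, F (act g z) = Fintype.card G * ∑ z ∈ Y, F z := by
    rw [Finset.sum_comm, ← Finset.card_univ, ← nsmul_eq_mul, ← Finset.sum_const]
    refine Finset.sum_congr rfl fun g _ => ?_
    refine Finset.sum_nbij' (act g) (act g⁻¹) (hmem g) (hmem g⁻¹) ?_ ?_ fun _ _ => rfl
    · intro z _
      rw [← hmul, inv_mul_cancel, hone]
    · intro z _
      rw [← hmul, mul_inv_cancel, hone]
  rw [← h1, h2]

/-- The three cardinalities determine the sizes of the four classes "in A or not, in B or not", so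
the classes can be matched bijectively. -/
theorem exists_perm_map_eq {U : Type*} [Fintype U] [DecidableEq U] {A A' B B' : Finset U}
    (hA : A.card = A'.card) (hB : B.card = B'.card) (hAB : (A ∩ B).card = (A' ∩ B').card) :
    ∃ σ : Equiv.Perm U, A.map σ.toEmbedding = A' ∧ B.map σ.toEmbedding = B' := by
  have key : ∀ A B : Finset U, ∀ c : Bool × Bool,
      Fintype.card {a // (decide (a ∈ A), decide (a ∈ B)) = c} =
        if c.1 then (if c.2 then (A ∩ B).card else A.card - (A ∩ B).card)
        else (if c.2 then B.card - (A ∩ B).card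
          else Fintype.card U - (A.card + B.card - (A ∩ B).card)) := by
    intro A B c
    rw [Fintype.card_subtype]
    rcases c with ⟨_ | _, _ | _⟩
    · rw [← Finset.card_union, ← Finset.card_compl]
      simp only [Bool.false_eq_true, if_false]
      refine congrArg Finset.card ?_
      ext a
      simp
    · rw [← Finset.card_sdiff]
      simp only [Bool.false_eq_true, if_false, if_true]
      congr 1
      ext a
      simp [and_comm]
    · rw [Finset.inter_comm, ← Finset.card_sdiff]
      simp only [Bool.false_eq_true, if_false, if_true]
      congr 1
      ext a
      simp
    · congr 1
      ext a
      simp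
  have hcard : ∀ c : Bool × Bool,
      Fintype.card {a // (decide (a ∈ A), decide (a ∈ B)) = c} =
        Fintype.card {a // (decide (a ∈ A'), decide (a ∈ B')) = c} := fun c => by
    rw [key, key, hA, hB, hAB]
  let σ : Equiv.Perm U := Equiv.ofFiberEquiv fun c => Fintype.equivOfCardEq (hcard c)
  have hσ : ∀ a, (decide (σ a ∈ A'), decide (σ a ∈ B')) = (decide (a ∈ A), decide (a ∈ B)) :=
    fun a => Equiv.ofFiberEquiv_map (f := fun a => (decide (a ∈ A), decide (a ∈ B)))
      (g := fun a => (decide (a ∈ A'), decide (a ∈ B'))) _ a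
  simp only [Prod.mk.injEq, decide_eq_decide] at hσ
  refine ⟨σ, ?_, ?_⟩
  · ext b
    rw [Finset.mem_map_equiv, ← (hσ _).1, Equiv.apply_symm_apply]
  · ext b
    rw [Finset.mem_map_equiv, ← (hσ _).2, Equiv.apply_symm_apply]

/-- The set from which Bob's block is drawn. -/
def blockSide {n : ℕ} (θ : Bool) (A : Finset (Fin n)) : Finset (Fin n) := if θ then Aᶜ else A

theorem card_blockSide {n s : ℕ} (θ : Bool) (A : SizedSet n s) :
    (blockSide θ A.1).card = if θ then n - s else s := by
  cases θ <;> simp [blockSide, A.2, Finset.card_compl]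

/-- The image of a set of size `s` under a permutation. -/
def SizedSet.perm {n s : ℕ} (σ : Equiv.Perm (Fin n)) (A : SizedSet n s) : SizedSet n s :=
  ⟨A.1.map σ.toEmbedding, by rw [Finset.card_map, A.2]⟩

theorem map_blockSide {n : ℕ} (θ : Bool) (A : Finset (Fin n)) (σ : Equiv.Perm (Fin n)) :
    (blockSide θ A).map σ.toEmbedding = blockSide θ (A.map σ.toEmbedding) := by
  cases θ
  · simp [blockSide]
  · ext a
    simp [blockSide, Finset.mem_map_equiv, -Finset.mem_map]

theorem inter_card_of_subset_blockSide {n p : ℕ} {θ : Bool} {A B : Finset (Fin n)}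
    (h : B ⊆ blockSide θ A) (hB : B.card = p) : (A ∩ B).card = if θ then 0 else p := by
  cases θ
  · simp only [blockSide, Bool.false_eq_true, if_false] at h ⊢
    rw [Finset.inter_eq_right.2 h, hB]
  · simp only [blockSide, if_true] at h ⊢
    rw [Finset.card_eq_zero, ← Finset.disjoint_iff_inter_eq_empty]
    exact (Finset.disjoint_left.2 fun a ha ha' => by simpa [ha] using h ha')

/-- The mean of `F S E` over independent uniform `s`-sets `S j` and a uniform block `E` of size `p`
inside `S i` (if `θ` is false) or outside `S i` (if `θ` is true). -/
noncomputable def blockMean {n m s : ℕ} (p : ℕ) (θ : Bool) (i : Fin m)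
    (F : (Fin m → SizedSet n s) → Finset (Fin n) → ℝ) : ℝ :=
  (Fintype.card (Fin m → SizedSet n s) : ℝ)⁻¹ * ∑ S : Fin m → SizedSet n s,
    (((Finset.powersetCard p (blockSide θ (S i).1)).card : ℝ)⁻¹ *
      ∑ E ∈ Finset.powersetCard p (blockSide θ (S i).1), F S E)

/-- The pairs of Alice's sets and a block. -/
def blockPairs (n m s p : ℕ) (θ : Bool) (i : Fin m) :
    Finset ((Fin m → SizedSet n s) × Finset (Fin n)) :=
  Finset.univ.filter fun z => z.2 ∈ Finset.powersetCard p (blockSide θ (z.1 i).1)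

theorem sum_blockPairs {n m s p : ℕ} {θ : Bool} {i : Fin m}
    (F : (Fin m → SizedSet n s) × Finset (Fin n) → ℝ) :
    ∑ z ∈ blockPairs n m s p θ i, F z = ∑ S : Fin m → SizedSet n s,
      ∑ E ∈ Finset.powersetCard p (blockSide θ (S i).1), F (S, E) :=
  Finset.sum_finset_product _ _ _ fun z => by simp [blockPairs]

/-- The number of admissible blocks is the same for every tuple, so the two-stage average is uniform
over pairs. This makes the orbit argument applicable. -/
theorem blockMean_eq {n m s p : ℕ} {θ : Bool} {i : Fin m}
    (F : (Fin m → SizedSet n s) → Finset (Fin n) → ℝ) :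
    blockMean p θ i F =
      ((blockPairs n m s p θ i).card : ℝ)⁻¹ * ∑ z ∈ blockPairs n m s p θ i, F z.1 z.2 := by
  have h := sum_blockPairs (p := p) (s := s) (n := n) (θ := θ) (i := i) fun _ => 1
  rw [Finset.sum_const, nsmul_eq_mul, mul_one] at h
  rw [h, sum_blockPairs, blockMean]
  simp only [Finset.sum_const, nsmul_eq_mul, mul_one, Finset.card_powersetCard, card_blockSide,
    Finset.card_univ]
  rw [← Finset.mul_sum, mul_inv]
  ring

theorem sum_perm_eq_blockMean {n m s p : ℕ} {θ : Bool} {i : Fin m}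
    (F : (Fin m → SizedSet n s) → Finset (Fin n) → ℝ) (S : Fin m → SizedSet n s)
    {E : Finset (Fin n)} (hE : E ∈ Finset.powersetCard p (blockSide θ (S i).1)) :
    ∑ σ : Fin m → Equiv.Perm (Fin n),
        F (fun j => (S j).perm (σ j)) (E.map (σ i).toEmbedding) =
      Fintype.card (Fin m → Equiv.Perm (Fin n)) * blockMean p θ i F := by
  have hmem : (S, E) ∈ blockPairs n m s p θ i := by simpa [blockPairs] using hE
  have h := card_mul_sum_orbit (G := Fin m → Equiv.Perm (Fin n)) (blockPairs n m s p θ i)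
    (fun σ z => (fun j => (z.1 j).perm (σ j), z.2.map (σ i).toEmbedding))
    (fun z => by
      refine Prod.ext (funext fun j => Subtype.ext ?_) ?_ <;>
      · ext a
        simp [SizedSet.perm]
        exact Iff.rfl)
    (fun g h z => by
      refine Prod.ext (funext fun j => Subtype.ext ?_) ?_ <;>
      · ext a
        simp [SizedSet.perm]
        exact Iff.rfl)
    (fun σ z hz => by
      simp only [blockPairs, Finset.mem_filter, Finset.mem_univ, true_and,
        Finset.mem_powersetCard, Finset.card_map] at hz ⊢
      refine ⟨?_, hz.2⟩
      rw [SizedSet.perm, ← map_blockSide]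
      exact Finset.map_subset_map.2 hz.1)
    (fun y hy z hz => by
      simp only [blockPairs, Finset.mem_filter, Finset.mem_univ, true_and,
        Finset.mem_powersetCard] at hy hz
      -- Transitivity: only the permutation at `i` must also carry the block, and there the
      -- intersection size is forced by the side (p inside, 0 outside).
      have h1 : ∀ j, ∃ σ : Equiv.Perm (Fin n), (y.1 j).perm σ = z.1 j ∧
          (j = i → y.2.map σ.toEmbedding = z.2) := by
        intro j
        by_cases hj : j = i
        · subst hj
          obtain ⟨σ, h1, h2⟩ := exists_perm_map_eq (A := (y.1 j).1) (A' := (z.1 j).1)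
            (B := y.2) (B' := z.2) (by rw [(y.1 j).2, (z.1 j).2]) (by rw [hy.2, hz.2])
            (by rw [inter_card_of_subset_blockSide hy.1 hy.2,
              inter_card_of_subset_blockSide hz.1 hz.2])
          exact ⟨σ, Subtype.ext h1, fun _ => h2⟩
        · obtain ⟨σ, h1, -⟩ := exists_perm_map_eq (A := (y.1 j).1) (A' := (z.1 j).1)
            (B := ∅) (B' := ∅) (by rw [(y.1 j).2, (z.1 j).2]) rfl (by simp)
          exact ⟨σ, Subtype.ext h1, fun h => absurd h hj⟩
      choose σ h1 h2 using h1
      exact ⟨σ, Prod.ext (funext h1) (h2 i rfl)⟩)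
    (fun z => F z.1 z.2) hmem
  have hpos : ((blockPairs n m s p θ i).card : ℝ) ≠ 0 := by
    exact_mod_cast (Finset.card_pos.2 ⟨_, hmem⟩).ne'
  rw [blockMean_eq, mul_left_comm, ← h, inv_mul_cancel_left₀ hpos]

/-! ### Hidden bits and indistinguishability of the two sides -/

/-- Sets that encode the bits `x`: one block of each of `q` pairs of disjoint blocks, and a rest that
does not depend on `x`. -/
theorem exists_blocks {n s p q : ℕ} (hq : p * q ≤ s) (hn : s + p * q ≤ n) :
    ∃ (P : Fin q → Bool → Finset (Fin n)) (S : (Fin q → Bool) → SizedSet n s),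
      ∀ x t θ, P t (xor θ (x t)) ∈ Finset.powersetCard p (blockSide θ (S x).1) := by
  -- The q pairs of blocks use 2pq points and the filler s − pq, in total s + pq ≤ n.
  have hcard : Fintype.card ((Fin q × Bool × Fin p) ⊕ Fin (s - p * q)) ≤ Fintype.card (Fin n) := by
    simp only [Fintype.card_sum, Fintype.card_prod, Fintype.card_fin, Fintype.card_bool]
    have : q * (2 * p) = 2 * (p * q) := by ring
    omega
  obtain ⟨e⟩ := Function.Embedding.nonempty_of_card_le hcard
  let P : Fin q → Bool → Finset (Fin n) := fun t b =>
    Finset.univ.map (⟨fun k => e (Sum.inl (t, b, k)), fun k k' h => by simpa using h⟩ :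
      Fin p ↪ Fin n)
  let g : (Fin q → Bool) → (Fin q × Fin p) ⊕ Fin (s - p * q) ↪ Fin n := fun x =>
    ⟨fun k => e (k.map (fun tk => (tk.1, x tk.1, tk.2)) id), fun k k' h => by
      have h := e.injective h
      rcases k with ⟨a, b⟩ | k <;> rcases k' with ⟨a', b'⟩ | k' <;> simp at h ⊢
      · exact ⟨h.1, h.2.2⟩
      · exact h⟩
  refine ⟨P, fun x => ⟨Finset.univ.map (g x), ?_⟩, fun x t θ => ?_⟩
  · rw [Finset.card_map, Finset.card_univ]
    simp only [Fintype.card_sum, Fintype.card_prod, Fintype.card_fin]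
    rw [mul_comm q p]
    omega
  · rw [Finset.mem_powersetCard]
    refine ⟨fun a ha => ?_, by simp [P]⟩
    simp only [P, Finset.mem_map, Finset.mem_univ, true_and] at ha
    obtain ⟨k, rfl⟩ := ha
    cases θ
    · simp only [blockSide, Bool.false_eq_true, if_false, Finset.mem_map, Finset.mem_univ,
        true_and]
      exact ⟨Sum.inl (t, k), by simp only [Bool.false_xor]; rfl⟩
    · simp only [blockSide, if_true, Finset.mem_compl, Finset.mem_map, Finset.mem_univ,
        true_and, not_exists]
      rintro (⟨t', k'⟩ | k') h
      · have h := e.injective h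
        simp only [Sum.map_inl, Sum.inl.injEq, Prod.mk.injEq] at h
        obtain ⟨rfl, h, -⟩ := h
        simp at h
      · have h := e.injective h
        simp at h

/-- Bob's tests cannot distinguish the two kinds of blocks after a short message. -/
theorem sum_blockMean_sub_le {n m s p q : ℕ} {W : Type*} (hq : p * q ≤ s) (hn : s + p * q ≤ n)
    (hq0 : 0 < q) (M : Finset W) (f : (Fin m → SizedSet n s) → W) (hf : ∀ S, f S ∈ M)
    (φ : W → Finset (Fin n) → Fin m → ℝ) (hφ0 : ∀ w E i, 0 ≤ φ w E i)
    (hφ1 : ∀ w E i, φ w E i ≤ 1) (l : ℝ) (hl : 0 < l) :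
    ∑ i : Fin m, (blockMean p true i (fun S E => φ (f S) E i) -
        blockMean p false i (fun S E => φ (f S) E i)) ≤
      Real.log M.card / (l * q) + l * m / 2 := by
  obtain ⟨P, S0, hP⟩ := exists_blocks hq hn
  let A : Bool → Fin m → ℝ := fun θ i => blockMean p θ i (fun S E => φ (f S) E i)
  let S : (Fin m × Fin q → Bool) → (Fin m → Equiv.Perm (Fin n)) → Fin m → SizedSet n s :=
    fun x σ j => (S0 fun t => x (j, t)).perm (σ j)
  have h1 : ∀ (θ : Bool) (x : Fin m × Fin q → Bool) (j : Fin m × Fin q),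
      ∑ σ : Fin m → Equiv.Perm (Fin n),
        φ (f (S x σ)) ((P j.2 (xor θ (x j))).map (σ j.1).toEmbedding) j.1 =
      Fintype.card (Fin m → Equiv.Perm (Fin n)) * A θ j.1 := fun θ x j =>
    sum_perm_eq_blockMean (fun S E => φ (f S) E j.1) (fun j => S0 fun t => x (j, t))
      (hP (fun t => x (j.1, t)) j.2 θ)
  set G : ℝ := (Fintype.card (Fin m → Equiv.Perm (Fin n)) : ℝ) with hG
  have hGpos : 0 < G := by
    rw [hG]
    exact_mod_cast Fintype.card_pos
  -- With the permutations fixed, the mq bits are still independent and uniform, and swapping the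
  -- blocks of a pair flips the sign of the difference of the tests.
  have h2 : ∀ σ : Fin m → Equiv.Perm (Fin n),
      ∑ x : Fin m × Fin q → Bool, ∑ j : Fin m × Fin q,
        (φ (f (S x σ)) ((P j.2 (!(x j))).map (σ j.1).toEmbedding) j.1 -
          φ (f (S x σ)) ((P j.2 (x j)).map (σ j.1).toEmbedding) j.1) ≤
      2 ^ (m * q) * (Real.log M.card / l + l * (m * q) / 2) := by
    intro σ
    have hφ : ∀ w E E' i, |φ w E i - φ w E' i| ≤ 1 := fun w E E' i => by
      have h := hφ0 w E i
      have h' := hφ0 w E' i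
      exact abs_sub_le_iff.2 ⟨by linarith [hφ1 w E i], by linarith [hφ1 w E' i]⟩
    have h := sum_correlation_le M (fun x => f (S x σ)) (fun x => hf _)
      (fun w (j : Fin m × Fin q) => φ w ((P j.2 false).map (σ j.1).toEmbedding) j.1 -
          φ w ((P j.2 true).map (σ j.1).toEmbedding) j.1)
      (fun w j => hφ w _ _ _) l hl
    simp only [Fintype.card_prod, Fintype.card_fin, Nat.cast_mul] at h
    refine le_trans (le_of_eq ?_) h
    refine Finset.sum_congr rfl fun x _ => Finset.sum_congr rfl fun j _ => ?_
    cases x j <;> simp [bitSign]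
  have h3 := Finset.sum_le_sum fun (σ : Fin m → Equiv.Perm (Fin n)) (_ : σ ∈ Finset.univ) => h2 σ
  rw [Finset.sum_comm] at h3
  have h4 : ∀ x : Fin m × Fin q → Bool, ∑ σ : Fin m → Equiv.Perm (Fin n), ∑ j : Fin m × Fin q,
        (φ (f (S x σ)) ((P j.2 (!(x j))).map (σ j.1).toEmbedding) j.1 -
          φ (f (S x σ)) ((P j.2 (x j)).map (σ j.1).toEmbedding) j.1) =
      G * (q * ∑ i, (A true i - A false i)) := by
    intro x
    rw [Finset.sum_comm]
    simp only [Finset.sum_sub_distrib]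
    have ht := fun j => h1 true x j
    have hf := fun j => h1 false x j
    simp only [Bool.true_xor] at ht
    simp only [Bool.false_xor] at hf
    simp only [ht, hf, ← Finset.mul_sum, ← mul_sub]
    simp only [Fintype.sum_prod_type, Finset.sum_const, Finset.card_univ, Fintype.card_fin,
      nsmul_eq_mul, ← Finset.mul_sum, mul_sub]
  rw [Finset.sum_congr rfl fun x _ => h4 x] at h3
  simp only [Finset.sum_const, Finset.card_univ, nsmul_eq_mul, ← hG] at h3
  rw [Fintype.card_fun, Fintype.card_prod, Fintype.card_fin, Fintype.card_fin,
    Fintype.card_bool] at h3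
  have hq' : (0 : ℝ) < q := by exact_mod_cast hq0
  have h5 : q * ∑ i, (A true i - A false i) ≤ Real.log M.card / l + l * (m * q) / 2 := by
    have h2pos : (0 : ℝ) < 2 ^ (m * q) := by positivity
    have : G * 2 ^ (m * q) * (q * ∑ i, (A true i - A false i)) ≤
        G * 2 ^ (m * q) * (Real.log M.card / l + l * (m * q) / 2) := by
      have h3' := h3
      push_cast at h3'
      linarith
    exact le_of_mul_le_mul_left this (by positivity)
  have h6 : Real.log M.card / (l * q) + l * m / 2 =
      (Real.log M.card / l + l * (m * q) / 2) / q := by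
    field_simp
  rw [h6, le_div_iff₀ hq', mul_comm]
  exact h5

/-! ### A block outside its set is rarely covered by few sets -/

/-- A random s-set contains b given points with probability at most (s/n)^b: drawing without
replacement, each conditional probability (s − j)/(n − j) is at most s/n. -/
theorem pow_mul_choose_sub_le {n s b : ℕ} (hb : b ≤ s) (hs : s ≤ n) :
    n ^ b * (n - b).choose (s - b) ≤ s ^ b * n.choose s := by
  induction b with
  | zero => simp
  | succ b ih =>
    have ih := ih (by omega)
    obtain ⟨k, rfl⟩ : ∃ k, s = b + 1 + k := ⟨s - (b + 1), by omega⟩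
    obtain ⟨l, rfl⟩ : ∃ l, n = b + 1 + l := ⟨n - (b + 1), by omega⟩
    have h1 : b + 1 + l - (b + 1) = l := by omega
    have h2 : b + 1 + k - (b + 1) = k := by omega
    have h3 : b + 1 + l - b = l + 1 := by omega
    have h4 : b + 1 + k - b = k + 1 := by omega
    rw [h1, h2]
    rw [h3, h4] at ih
    have h5 := Nat.add_one_mul_choose_eq l k
    have h6 : (b + 1 + l) * l.choose k ≤ (b + 1 + k) * (l + 1).choose (k + 1) := by
      refine le_of_mul_le_mul_left (a := l + 1) ?_ (Nat.succ_pos l)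
      have h7 : (b + 1 + l) * (k + 1) ≤ (b + 1 + k) * (l + 1) := by nlinarith
      calc (l + 1) * ((b + 1 + l) * l.choose k) = (b + 1 + l) * ((l + 1) * l.choose k) := by ring
        _ = (b + 1 + l) * (k + 1) * (l + 1).choose (k + 1) := by rw [h5]; ring
        _ ≤ (b + 1 + k) * (l + 1) * (l + 1).choose (k + 1) := Nat.mul_le_mul_right _ h7
        _ = _ := by ring
    calc (b + 1 + l) ^ (b + 1) * l.choose k = (b + 1 + l) ^ b * ((b + 1 + l) * l.choose k) := by
          ring
      _ ≤ (b + 1 + l) ^ b * ((b + 1 + k) * (l + 1).choose (k + 1)) := Nat.mul_le_mul_left _ h6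
      _ = (b + 1 + k) * ((b + 1 + l) ^ b * (l + 1).choose (k + 1)) := by ring
      _ ≤ (b + 1 + k) * ((b + 1 + k) ^ b * (b + 1 + l).choose (b + 1 + k)) :=
          Nat.mul_le_mul_left _ ih
      _ = _ := by ring

theorem card_sizedSet_superset {n s : ℕ} (B : Finset (Fin n)) :
    n ^ B.card * (Finset.univ.filter fun A : SizedSet n s => B ⊆ A.1).card ≤
      s ^ B.card * Fintype.card (SizedSet n s) := by
  have hmap : ((Finset.univ.filter fun A : SizedSet n s => B ⊆ A.1).card) =
      ((Finset.powersetCard s (Finset.univ : Finset (Fin n))).filter (B ⊆ ·)).card := by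
    refine Finset.card_bij' (fun A _ => A.1)
      (fun A hA => ⟨A, (Finset.mem_powersetCard.1 (Finset.mem_filter.1 hA).1).2⟩) ?_ ?_ ?_ ?_
    · intro A hA
      simpa [A.2] using hA
    · intro A hA
      simpa using (Finset.mem_filter.1 hA).2
    · intro A hA
      rfl
    · intro A hA
      rfl
  have hall : Fintype.card (SizedSet n s) = n.choose s := by
    simp [SizedSet, Fintype.card_finset_len]
  by_cases hB : B.card ≤ s
  · by_cases hs : s ≤ n
    · rw [hmap, Finset.card_filter_powersetCard_subset _ _ _ (Finset.subset_univ _) hB, hall,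
        Finset.card_univ, Fintype.card_fin]
      exact pow_mul_choose_sub_le hB hs
    · have : (Finset.univ.filter fun A : SizedSet n s => B ⊆ A.1).card ≤
          Fintype.card (SizedSet n s) := Finset.card_le_univ _
      rw [hall, Nat.choose_eq_zero_of_lt (by omega)] at this
      rw [Nat.le_zero.1 this]
      simp
  · have : (Finset.univ.filter fun A : SizedSet n s => B ⊆ A.1) = ∅ := by
      refine Finset.filter_eq_empty_iff.2 fun A _ h => hB ?_
      rw [← A.2]
      exact Finset.card_le_card h
    rw [this]
    simp

theorem card_filter_forall {ι A : Type*} [Fintype ι] [DecidableEq ι] [Fintype A]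
    (Q : ι → A → Prop) [∀ i, DecidablePred (Q i)] [DecidablePred fun S : ι → A => ∀ i, Q i (S i)] :
    (Finset.univ.filter fun S : ι → A => ∀ i, Q i (S i)).card =
      ∏ i, (Finset.univ.filter (Q i)).card := by
  rw [← Fintype.card_piFinset]
  congr 1
  ext S
  simp [Fintype.mem_piFinset]

open Classical in
/-- Covering a block outside `S i` by prescribed sets is unlikely. -/
theorem card_prescribed_cover_le {n m s : ℕ} (i : Fin m) (E : Finset (Fin n))
    (g : E → Fin m) :
    n ^ E.card * (Finset.univ.filter fun S : Fin m → SizedSet n s =>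
        E ⊆ (S i).1ᶜ ∧ ∀ e : E, e.1 ∈ (S (g e)).1).card ≤
      s ^ E.card * (Finset.univ.filter fun S : Fin m → SizedSet n s => E ⊆ (S i).1ᶜ).card := by
  -- `B j` collects the points assigned to `S j`. The event splits into conditions on the individual
  -- sets, so the count is a product over j.
  let B : Fin m → Finset (Fin n) := fun j =>
    (Finset.univ.filter fun e : E => g e = j).map (Function.Embedding.subtype _)
  have hB : E.card = ∑ j, (B j).card := by
    simp only [B, Finset.card_map]
    rw [← Fintype.card_coe, ← Finset.card_univ]
    exact Finset.card_eq_sum_card_fiberwise fun _ _ => Finset.mem_coe.2 (Finset.mem_univ _)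
  have hmemB : ∀ j a, a ∈ B j ↔ ∃ h : a ∈ E, g ⟨a, h⟩ = j := by
    intro j a
    simp [B]
  have h1 : (Finset.univ.filter fun S : Fin m → SizedSet n s =>
        E ⊆ (S i).1ᶜ ∧ ∀ e : E, e.1 ∈ (S (g e)).1) =
      Finset.univ.filter fun S : Fin m → SizedSet n s =>
        ∀ j, (j = i → E ⊆ (S j).1ᶜ) ∧ B j ⊆ (S j).1 := by
    ext S
    simp only [Finset.mem_filter, Finset.mem_univ, true_and]
    constructor
    · rintro ⟨h1, h2⟩ j
      refine ⟨fun h => h ▸ h1, fun a ha => ?_⟩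
      obtain ⟨h, rfl⟩ := (hmemB _ _).1 ha
      exact h2 ⟨a, h⟩
    · intro h
      exact ⟨(h i).1 rfl, fun e => (h (g e)).2 ((hmemB _ _).2 ⟨e.2, rfl⟩)⟩
  have h2 : (Finset.univ.filter fun S : Fin m → SizedSet n s => E ⊆ (S i).1ᶜ) =
      Finset.univ.filter fun S : Fin m → SizedSet n s => ∀ j, (j = i → E ⊆ (S j).1ᶜ) := by
    ext S
    simp
  rw [h1, h2, card_filter_forall (fun j (A : SizedSet n s) => (j = i → E ⊆ A.1ᶜ) ∧ B j ⊆ A.1),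
    card_filter_forall (fun j (A : SizedSet n s) => (j = i → E ⊆ A.1ᶜ)), hB,
    ← Finset.prod_pow_eq_pow_sum, ← Finset.prod_pow_eq_pow_sum, ← Finset.prod_mul_distrib,
    ← Finset.prod_mul_distrib]
  refine Finset.prod_le_prod' fun j _ => ?_
  -- `S i` is conditioned to avoid `E`, so it can serve no point: either `B i` is empty or the event
  -- is.
  by_cases hj : j = i
  · rcases (B j).eq_empty_or_nonempty with h0 | ⟨a, ha⟩
    · rw [h0]
      simp
    · have : (Finset.univ.filter fun A : SizedSet n s =>
          (j = i → E ⊆ A.1ᶜ) ∧ B j ⊆ A.1) = ∅ := by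
        refine Finset.filter_eq_empty_iff.2 fun A _ h => ?_
        obtain ⟨haE, -⟩ := (hmemB _ _).1 ha
        exact Finset.mem_compl.1 (h.1 hj haE) (h.2 ha)
      rw [this]
      simp
  · simpa [hj] using card_sizedSet_superset (s := s) (B j)

/-- The set `E` is covered by the union of `K` of the sets `S j`. -/
def CoveredBy {n m s : ℕ} (K : ℕ) (S : Fin m → SizedSet n s) (E : Finset (Fin n)) : Prop :=
  ∃ f : Fin K → Fin m, ∀ e ∈ E, ∃ k, e ∈ (S (f k)).1

open Classical in
-- Union bound over the m^K choices of sets and the K^|E| assignments of the points of `E` to them.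
theorem card_coveredBy_le {n m s : ℕ} (K : ℕ) (i : Fin m) (E : Finset (Fin n)) :
    n ^ E.card * (Finset.univ.filter fun S : Fin m → SizedSet n s =>
        E ⊆ (S i).1ᶜ ∧ CoveredBy K S E).card ≤
      m ^ K * (K * s) ^ E.card *
        (Finset.univ.filter fun S : Fin m → SizedSet n s => E ⊆ (S i).1ᶜ).card := by
  have hsub : (Finset.univ.filter fun S : Fin m → SizedSet n s =>
        E ⊆ (S i).1ᶜ ∧ CoveredBy K S E) ⊆
      (Finset.univ : Finset ((Fin K → Fin m) × (E → Fin K))).biUnion fun fh =>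
        Finset.univ.filter fun S : Fin m → SizedSet n s =>
          E ⊆ (S i).1ᶜ ∧ ∀ e : E, e.1 ∈ (S ((fh.1 ∘ fh.2) e)).1 := by
    intro S hS
    simp only [Finset.mem_filter, Finset.mem_univ, true_and] at hS
    obtain ⟨h1, f, hf⟩ := hS
    choose h hh using fun e : E => hf e.1 e.2
    simp only [Finset.mem_biUnion, Finset.mem_univ, true_and, Finset.mem_filter]
    exact ⟨(f, h), h1, hh⟩
  have h1 := (Finset.card_le_card hsub).trans Finset.card_biUnion_le
  refine (Nat.mul_le_mul_left _ h1).trans ?_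
  rw [Finset.mul_sum]
  refine (Finset.sum_le_sum fun fh _ => card_prescribed_cover_le i E (fh.1 ∘ fh.2)).trans ?_
  rw [Finset.sum_const, Finset.card_univ, Fintype.card_prod, Fintype.card_fun, Fintype.card_fun,
    Fintype.card_fin, Fintype.card_fin, Fintype.card_coe, smul_eq_mul, mul_pow]
  exact le_of_eq (by ring)

/-- Drawing the block before the sets allows the union bound to be applied for each fixed block. -/
theorem sum_blockPairs_true {n m s p : ℕ} {i : Fin m}
    (F : (Fin m → SizedSet n s) × Finset (Fin n) → ℝ) :
    ∑ z ∈ blockPairs n m s p true i, F z =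
      ∑ E ∈ Finset.powersetCard p Finset.univ,
        ∑ S ∈ Finset.univ.filter fun S : Fin m → SizedSet n s => E ⊆ (S i).1ᶜ, F (S, E) :=
  Finset.sum_finset_product_right _ _ _ fun z => by
    simp [blockPairs, blockSide, Finset.mem_powersetCard, and_comm]

open Classical in
theorem blockMean_coveredBy_le {n m s p : ℕ} (hn : 0 < n) (K : ℕ) (i : Fin m) :
    blockMean p true i (fun (S : Fin m → SizedSet n s) E => if CoveredBy K S E then 1 else 0) ≤
      (m : ℝ) ^ K * ((K * s : ℝ) / n) ^ p := by
  have hn' : (0 : ℝ) < n := by exact_mod_cast hn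
  have h1 : ∑ z ∈ blockPairs n m s p true i, (if CoveredBy K z.1 z.2 then (1 : ℝ) else 0) ≤
      (m : ℝ) ^ K * ((K * s : ℝ) / n) ^ p * (blockPairs n m s p true i).card := by
    have hc := sum_blockPairs_true (n := n) (m := m) (s := s) (p := p) (i := i) fun _ => 1
    rw [Finset.sum_const, nsmul_eq_mul, mul_one] at hc
    rw [hc, sum_blockPairs_true, Finset.mul_sum]
    refine Finset.sum_le_sum fun E hE => ?_
    have hE := (Finset.mem_powersetCard.1 hE).2
    rw [Finset.sum_boole, Finset.filter_filter, Finset.sum_const, nsmul_eq_mul, mul_one]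
    have h := card_coveredBy_le (s := s) K i E
    rw [hE] at h
    have h' : (n : ℝ) ^ p * ((Finset.univ.filter fun S : Fin m → SizedSet n s =>
        E ⊆ (S i).1ᶜ ∧ CoveredBy K S E).card : ℝ) ≤ (m : ℝ) ^ K * (K * s) ^ p *
        ((Finset.univ.filter fun S : Fin m → SizedSet n s => E ⊆ (S i).1ᶜ).card : ℝ) := by
      exact_mod_cast h
    rw [div_pow, mul_div_assoc', div_mul_eq_mul_div, le_div_iff₀ (by positivity), mul_comm]
    exact h'
  rw [blockMean_eq]
  by_cases h0 : (blockPairs n m s p true i).card = 0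
  · rw [h0]
    simp only [Nat.cast_zero, inv_zero, zero_mul]
    positivity
  · have hpos : (0 : ℝ) < (blockPairs n m s p true i).card := by
      exact_mod_cast Nat.pos_of_ne_zero h0
    rw [inv_mul_le_iff₀ hpos, mul_comm]
    exact h1

/-! ### The optimum and the two kinds of blocks -/

theorem setCoverSize_le_two {n m : ℕ} (S : Fin m → Finset (Fin n)) {E : Finset (Fin n)} {i : Fin m}
    (hE : E ⊆ S i) : setCoverSize (fun j : Option (Fin m) => j.elim Eᶜ S) ≤ 2 := by
  have h : ∀ u : Fin n, ∃ j ∈ ({none, some i} : Finset (Option (Fin m))), u ∈ j.elim Eᶜ S := by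
    intro u
    by_cases hu : u ∈ E
    · exact ⟨some i, by simp, hE hu⟩
    · exact ⟨none, by simp, by simpa using hu⟩
  refine (iInf₂_le _ h).trans ?_
  have : ({none, some i} : Finset (Option (Fin m))).card ≤ 2 := Finset.card_le_two
  exact_mod_cast this

/-- Bob's set misses `E` entirely, so in any cover the sets of Alice alone cover `E`. -/
theorem coveredBy_of_setCoverSize_le {n m s : ℕ} {a : ℝ} (ha : 0 ≤ a) {S : Fin m → SizedSet n s}
    {E : Finset (Fin n)} (hE : E.Nonempty)
    (h : ((setCoverSize (fun j : Option (Fin m) => j.elim Eᶜ fun j => (S j).1) : ℕ∞) : ℝ≥0∞) ≤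
      ENNReal.ofReal a) : CoveredBy ⌊a⌋₊ S E := by
  classical
  by_contra hcon
  have h1 : ((⌊a⌋₊ + 1 : ℕ) : ℕ∞) ≤
      setCoverSize (fun j : Option (Fin m) => j.elim Eᶜ fun j => (S j).1) := by
    refine le_iInf₂ fun I hI => ?_
    by_contra hlt
    have hcard : I.card ≤ ⌊a⌋₊ := by
      have : I.card < ⌊a⌋₊ + 1 := by exact_mod_cast not_le.1 hlt
      omega
    have hmem : ∀ e ∈ E, ∃ j, some j ∈ I ∧ e ∈ (S j).1 := by
      intro e he
      obtain ⟨j, hj, hej⟩ := hI e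
      cases j with
      | none => exact absurd he (by simpa using hej)
      | some j => exact ⟨j, hj, hej⟩
    obtain ⟨e0, he0⟩ := hE
    obtain ⟨j0, -, -⟩ := hmem e0 he0
    have hemb : Fintype.card I ≤ Fintype.card (Fin ⌊a⌋₊) := by simpa using hcard
    obtain ⟨em⟩ := Function.Embedding.nonempty_of_card_le hemb
    -- The cover may have fewer than ⌊a⌋ members and may contain Bob's set; the superfluous places
    -- are filled with an arbitrary `j0`, which exists because `E` is nonempty.
    refine hcon ⟨fun k => if hk : ∃ x, em x = k then hk.choose.1.getD j0 else j0, fun e he => ?_⟩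
    obtain ⟨j, hj, hej⟩ := hmem e he
    refine ⟨em ⟨some j, hj⟩, ?_⟩
    have hk : ∃ x, em x = em ⟨some j, hj⟩ := ⟨_, rfl⟩
    have hx : hk.choose = ⟨some j, hj⟩ := em.injective hk.choose_spec
    simpa only [dif_pos hk, hx, Option.getD_some] using hej
  have h2 : ((⌊a⌋₊ + 1 : ℕ) : ℝ≥0∞) ≤ ENNReal.ofReal a := by
    refine le_trans ?_ h
    have := ENat.toENNReal_le.2 h1
    simpa using this
  rw [← ENNReal.ofReal_natCast, ENNReal.ofReal_le_ofReal_iff ha] at h2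
  have := Nat.lt_floor_add_one a
  push_cast at h2
  linarith

/-! ### Error of deterministic protocols with short messages -/

/-- The bit strings of length at most `b`. -/
def shortLists (b : ℕ) : Finset (List Bool) :=
  (Finset.range (b + 1)).biUnion fun k => Finset.univ.image fun v : Fin k → Bool => List.ofFn v

theorem mem_shortLists {b : ℕ} {w : List Bool} (h : w.length ≤ b) : w ∈ shortLists b := by
  simp only [shortLists, Finset.mem_biUnion, Finset.mem_range, Finset.mem_image, Finset.mem_univ,
    true_and]
  exact ⟨w.length, by omega, w.get, List.ofFn_get w⟩

theorem card_shortLists_le (b : ℕ) : (shortLists b).card ≤ 2 ^ (b + 1) := by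
  refine Finset.card_biUnion_le.trans ?_
  refine (Finset.sum_le_sum fun k _ => Finset.card_image_le).trans ?_
  simp only [Finset.card_univ, Fintype.card_fun, Fintype.card_bool, Fintype.card_fin]
  exact (Nat.geomSum_lt (le_refl 2) fun k hk => Finset.mem_range.1 hk).le

theorem blockMean_mono {n m s p : ℕ} {θ : Bool} {i : Fin m}
    {F G : (Fin m → SizedSet n s) → Finset (Fin n) → ℝ}
    (h : ∀ S, ∀ E ∈ Finset.powersetCard p (blockSide θ (S i).1), F S E ≤ G S E) :
    blockMean p θ i F ≤ blockMean p θ i G := by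
  unfold blockMean
  gcongr with S _ E hE
  exact h S E hE

theorem blockMean_sub {n m s p : ℕ} {θ : Bool} {i : Fin m}
    (F G : (Fin m → SizedSet n s) → Finset (Fin n) → ℝ) :
    blockMean p θ i (fun S E => F S E - G S E) = blockMean p θ i F - blockMean p θ i G := by
  simp only [blockMean, Finset.sum_sub_distrib, mul_sub]

theorem blockMean_one {n m s p : ℕ} (h : EstParams n m s p) (θ : Bool) (i : Fin m) :
    blockMean p θ i (fun (_ : Fin m → SizedSet n s) _ => (1 : ℝ)) = 1 := by
  have _ : Nonempty (SizedSet n s) := SizedSet.nonempty (le_trans (Nat.le_add_right s p) h.add_le)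
  have h1 : ∀ S : Fin m → SizedSet n s,
      ((Finset.powersetCard p (blockSide θ (S i).1)).card : ℝ) ≠ 0 := fun S => by
    exact_mod_cast (Finset.card_pos.2 (h.block_nonempty (S i) θ)).ne'
  have h2 : (Fintype.card (Fin m → SizedSet n s) : ℝ) ≠ 0 := by
    exact_mod_cast Fintype.card_ne_zero
  simp only [blockMean, Finset.sum_const, nsmul_eq_mul, mul_one, inv_mul_cancel₀ (h1 _),
    Finset.card_univ, inv_mul_cancel₀ h2]

theorem tsum_distEstIdx_mul {n m s p : ℕ} (h : EstParams n m s p)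
    (G : (Fin m → Finset (Fin n)) × (Finset (Fin n) × Fin m) → ℝ) (hG : ∀ z, 0 ≤ G z) :
    ∑' z, distEstIdx n m s p h z * ENNReal.ofReal (G z) =
      ENNReal.ofReal ((m : ℝ)⁻¹ * ∑ i : Fin m, (2 : ℝ)⁻¹ *
        (blockMean p false i (fun (S : Fin m → SizedSet n s) E => G (fun j => (S j).1, (Eᶜ, i))) +
          blockMean p true i
            (fun (S : Fin m → SizedSet n s) E => G (fun j => (S j).1, (Eᶜ, i))))) := by
  have _ : Nonempty (SizedSet n s) := SizedSet.nonempty (le_trans (Nat.le_add_right s p) h.add_le)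
  have _ : Nonempty (Fin m) := ⟨⟨0, h.m_pos⟩⟩
  have hs : ∀ {A : Type} (t : Finset A) (F : A → ℝ), (∀ a, 0 ≤ F a) →
      0 ≤ (t.card : ℝ)⁻¹ * ∑ a ∈ t, F a := fun t F hF =>
    mul_nonneg (by positivity) (Finset.sum_nonneg fun a _ => hF a)
  rw [distEstIdx, PMF.tsum_bind_mul]
  simp only [PMF.tsum_bind_mul, PMF.tsum_map_mul]
  have e1 : ∀ (S : Fin m → SizedSet n s) (i : Fin m) (θ : Bool),
      ∑' E, PMF.uniformOfFinset (Finset.powersetCard p (if θ then (S i).1ᶜ else (S i).1))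
        (h.block_nonempty (S i) θ) E * ENNReal.ofReal (G (fun j => (S j).1, (Eᶜ, i))) = _ :=
    fun S i θ => PMF.tsum_uniformOfFinset_mul _ _ _ fun E => hG _
  simp only [e1]
  have e2 : ∀ (S : Fin m → SizedSet n s) (i : Fin m),
      ∑' θ, PMF.uniformOfFintype Bool θ * ENNReal.ofReal
        (((Finset.powersetCard p (if θ then (S i).1ᶜ else (S i).1)).card : ℝ)⁻¹ *
          ∑ E ∈ Finset.powersetCard p (if θ then (S i).1ᶜ else (S i).1),
            G (fun j => (S j).1, (Eᶜ, i))) = _ :=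
    fun S i => PMF.tsum_uniformOfFintype_mul _ fun θ => hs _ _ fun E => hG _
  simp only [e2]
  have e3 := fun S : Fin m → SizedSet n s => PMF.tsum_uniformOfFintype_mul (A := Fin m)
    (fun i => (Fintype.card Bool : ℝ)⁻¹ * ∑ θ : Bool,
      (((Finset.powersetCard p (if θ then (S i).1ᶜ else (S i).1)).card : ℝ)⁻¹ *
          ∑ E ∈ Finset.powersetCard p (if θ then (S i).1ᶜ else (S i).1),
            G (fun j => (S j).1, (Eᶜ, i))))
    fun i => hs _ _ fun θ => hs _ _ fun E => hG _
  simp only [e3]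
  refine (PMF.tsum_uniformOfFintype_mul _ fun S =>
    hs _ _ fun i => hs _ _ fun θ => hs _ _ fun E => hG _).trans ?_
  congr 1
  simp only [Finset.card_univ, Fintype.card_fin, Fintype.card_bool, Fintype.sum_bool,
    Nat.cast_ofNat, blockMean, blockSide]
  rw [← Finset.mul_sum, mul_left_comm, Finset.sum_comm, Finset.mul_sum]
  congr 1
  refine Finset.sum_congr rfl fun i _ => ?_
  rw [← Finset.mul_sum, Finset.sum_add_distrib]
  ring

open Classical in
/-- A deterministic protocol with short messages errs with probability close to one half. -/
theorem deterministic_error_ge {n m s p q b : ℕ} (h : EstParams n m s p) (hp : 0 < p)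
    (hq0 : 0 < q) (hq : p * q ≤ s) (hn : s + p * q ≤ n) {α : ℝ} (hα : 0 ≤ α)
    (f : (Fin m → Finset (Fin n)) → List Bool)
    (hf : ∀ S : Fin m → SizedSet n s, (f fun j => (S j).1).length ≤ b)
    (g : List Bool → Finset (Fin n) × Fin m → ℝ≥0∞) {l : ℝ} (hl : 0 < l) :
    ENNReal.ofReal (1 / 2 - ((m : ℝ) ^ ⌊2 * α⌋₊ * ((⌊2 * α⌋₊ * s : ℝ) / n) ^ p +
        ((b + 1) * Real.log 2 / (l * (m * q)) + l / 2)) / 2) ≤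
      ∑' z, distEstIdx n m s p h z *
        (if SetCoverEstIdx n m α z.1 z.2 (g (f z.1) z.2) then 0 else 1) := by
  have hm : (0 : ℝ) < m := by exact_mod_cast h.m_pos
  have hq' : (0 : ℝ) < q := by exact_mod_cast hq0
  have hn0 : 0 < n := by
    have := h.p_le
    omega
  let G : (Fin m → Finset (Fin n)) × (Finset (Fin n) × Fin m) → ℝ := fun z =>
    if SetCoverEstIdx n m α z.1 z.2 (g (f z.1) z.2) then 0 else 1
  have hG : ∀ z, (if SetCoverEstIdx n m α z.1 z.2 (g (f z.1) z.2) then (0 : ℝ≥0∞) else 1) =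
      ENNReal.ofReal (G z) := fun z => by
    simp only [G]
    split_ifs <;> simp
  simp only [hG]
  rw [tsum_distEstIdx_mul h G fun z => by simp only [G]; split_ifs <;> norm_num]
  refine ENNReal.ofReal_le_ofReal ?_
  let F : (Fin m → SizedSet n s) → List Bool := fun S => f fun j => (S j).1
  -- The test derived from the answer: value 1 is the guess θ = 1.
  let φ : List Bool → Finset (Fin n) → Fin m → ℝ := fun w E i =>
    if g w (Eᶜ, i) ≤ ENNReal.ofReal (2 * α) then 0 else 1
  set η : ℝ := (m : ℝ) ^ ⌊2 * α⌋₊ * ((⌊2 * α⌋₊ * s : ℝ) / n) ^ p with hη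
  -- For θ = 0 every answer above 2α is wrong, since opt ≤ 2.
  have h0 : ∀ i : Fin m, blockMean p false i (fun S E => φ (F S) E i) ≤
      blockMean p false i
        (fun (S : Fin m → SizedSet n s) E => G (fun j => (S j).1, (Eᶜ, i))) := by
    intro i
    refine blockMean_mono fun S E hE => ?_
    simp only [φ, G, F]
    split_ifs with h1 h2 h2 <;> try norm_num
    refine h1 (h2.2.trans ?_)
    rw [mul_comm 2 α, ENNReal.ofReal_mul hα]
    gcongr
    have h3 := setCoverSize_le_two (fun j => (S j).1) (i := i) (E := E)
      (by simpa [blockSide] using (Finset.mem_powersetCard.1 hE).1)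
    simpa using ENat.toENNReal_le.2 h3
  -- For θ = 1 an answer of at most 2α is correct only if the block is covered by ⌊2α⌋ sets, which
  -- has probability at most η.
  have h1 : ∀ i : Fin m, 1 - blockMean p true i (fun S E => φ (F S) E i) - η ≤
      blockMean p true i
        (fun (S : Fin m → SizedSet n s) E => G (fun j => (S j).1, (Eᶜ, i))) := by
    intro i
    have hc := blockMean_coveredBy_le (m := m) (s := s) (p := p) hn0 ⌊2 * α⌋₊ i
    rw [← blockMean_one h true i]
    refine le_trans (sub_le_sub_left hc _) ?_
    rw [← blockMean_sub, ← blockMean_sub]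
    refine blockMean_mono fun S E hE => ?_
    simp only [φ, G, F]
    have hE' : E.Nonempty := by
      rw [← Finset.card_pos, (Finset.mem_powersetCard.1 hE).2]
      exact hp
    split_ifs with h1 h2 h3 h3 <;> try norm_num
    exact h2 (coveredBy_of_setCoverSize_le (by positivity) hE' (h3.1.trans h1))
  have hd := sum_blockMean_sub_le hq hn hq0 (shortLists b) F (fun S => mem_shortLists (hf S)) φ
    (fun w E i => by simp only [φ]; split_ifs <;> norm_num)
    (fun w E i => by simp only [φ]; split_ifs <;> norm_num) l hl
  have hlog : Real.log (shortLists b).card ≤ (b + 1) * Real.log 2 := by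
    have hpos : (0 : ℝ) < (shortLists b).card := by
      exact_mod_cast Finset.card_pos.2 ⟨[], mem_shortLists (by simp)⟩
    have hle : ((shortLists b).card : ℝ) ≤ 2 ^ (b + 1) := by
      exact_mod_cast card_shortLists_le b
    refine (Real.log_le_log hpos hle).trans_eq ?_
    rw [Real.log_pow]
    push_cast
    ring
  have hd' : ∑ i : Fin m, (blockMean p true i (fun S E => φ (F S) E i) -
      blockMean p false i (fun S E => φ (F S) E i)) ≤
      m * ((b + 1) * Real.log 2 / (l * (m * q)) + l / 2) := by
    refine hd.trans ?_
    have e : m * ((b + 1) * Real.log 2 / (l * (m * q)) + l / 2) =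
        (b + 1) * Real.log 2 / (l * q) + l * m / 2 := by
      field_simp
    rw [e]
    gcongr
  rw [inv_mul_eq_div, le_div_iff₀ hm]
  have hsum : ∑ i : Fin m, (2 : ℝ)⁻¹ * (1 - η - (blockMean p true i (fun S E => φ (F S) E i) -
      blockMean p false i (fun S E => φ (F S) E i))) ≤ ∑ i : Fin m, (2 : ℝ)⁻¹ *
        (blockMean p false i (fun (S : Fin m → SizedSet n s) E => G (fun j => (S j).1, (Eᶜ, i))) +
          blockMean p true i
            (fun (S : Fin m → SizedSet n s) E => G (fun j => (S j).1, (Eᶜ, i)))) := by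
    refine Finset.sum_le_sum fun i _ => ?_
    have := h0 i
    have := h1 i
    linarith
  refine le_trans ?_ hsum
  rw [← Finset.mul_sum, Finset.sum_sub_distrib, Finset.sum_const, Finset.card_univ,
    Fintype.card_fin, nsmul_eq_mul]
  linarith

/-! ### From deterministic protocols to communication complexity -/

open Classical in
/-- A lower bound on the error of all deterministic protocols obtained by fixing the randomness is
a lower bound on the error. -/
theorem OneWayProtocol.le_error {X Y Z : Type} [MeasurableSpace Z] [Countable (X × Y)]
    (π : OneWayProtocol X Y Z) (P : X → Y → Z → Prop) (D : PMF (X × Y)) (c : ℝ≥0∞)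
    (h : ∀ r a b, c ≤ ∑' z : X × Y, D z *
      (if P z.1 z.2 (π.out (π.msg z.1 r a) z.2 r b) then 0 else 1)) : c ≤ π.error P D := by
  let μ := π.lawPub.prod (π.lawA.prod π.lawB)
  let bad : X × Y → Set (π.Pub × π.PrivA × π.PrivB) := fun z =>
    {ω | ¬ P z.1 z.2 (π.out (π.msg z.1 ω.1 ω.2.1) z.2 ω.1 ω.2.2)}
  -- The relation `P` is arbitrary, so the error events need not be measurable; measurable hulls
  -- have the same measure.
  have hmeas : ∀ z, Measurable ((toMeasurable μ (bad z)).indicator fun _ => (1 : ℝ≥0∞)) := fun z =>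
    measurable_const.indicator (measurableSet_toMeasurable _ _)
  calc c = ∫⁻ _, c ∂μ := by simp [μ]
    _ ≤ ∫⁻ ω, ∑' z, D z * (toMeasurable μ (bad z)).indicator (fun _ => (1 : ℝ≥0∞)) ω ∂μ := by
        refine lintegral_mono fun ω => (h ω.1 ω.2.1 ω.2.2).trans ?_
        refine ENNReal.tsum_le_tsum fun z => ?_
        gcongr
        split_ifs with hP
        · exact zero_le
        · have : ω ∈ toMeasurable μ (bad z) := subset_toMeasurable _ _ hP
          simp [this]
    _ = ∑' z, D z * μ (toMeasurable μ (bad z)) := by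
        rw [lintegral_tsum fun z => ((hmeas z).const_mul _).aemeasurable]
        refine tsum_congr fun z => ?_
        rw [lintegral_const_mul _ (hmeas z), lintegral_indicator_const
          (measurableSet_toMeasurable _ _), one_mul]
    _ = π.error P D := by
        simp only [measure_toMeasurable]
        rfl

theorem exists_mem_support_distEstIdx {n m s p : ℕ} (h : EstParams n m s p)
    (S : Fin m → SizedSet n s) : ∃ y, ((fun j => (S j).1), y) ∈ (distEstIdx n m s p h).support := by
  obtain ⟨E, hE⟩ := h.block_nonempty (S ⟨0, h.m_pos⟩) false
  refine ⟨(Eᶜ, ⟨0, h.m_pos⟩), ?_⟩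
  have _ : Nonempty (SizedSet n s) := SizedSet.nonempty (le_trans (Nat.le_add_right s p) h.add_le)
  have _ : Nonempty (Fin m) := ⟨⟨0, h.m_pos⟩⟩
  rw [distEstIdx, PMF.mem_support_bind_iff]
  refine ⟨S, PMF.mem_support_uniformOfFintype _, ?_⟩
  rw [PMF.mem_support_bind_iff]
  refine ⟨⟨0, h.m_pos⟩, PMF.mem_support_uniformOfFintype _, ?_⟩
  rw [PMF.mem_support_bind_iff]
  refine ⟨false, PMF.mem_support_uniformOfFintype _, ?_⟩
  rw [PMF.mem_support_map_iff]
  exact ⟨E, (PMF.mem_support_uniformOfFinset_iff _ _).2 hE, rfl⟩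

theorem exists_mem_support_distEst {n m s p : ℕ} (h : EstParams n m s p)
    (S : Fin m → SizedSet n s) : ∃ y, ((fun j => (S j).1), y) ∈ (distEst n m s p h).support := by
  obtain ⟨y, hy⟩ := exists_mem_support_distEstIdx h S
  refine ⟨y.1, ?_⟩
  rw [distEst, PMF.mem_support_map_iff]
  exact ⟨_, hy, rfl⟩

theorem OneWayProtocol.length_msg_le {X Y Z : Type} [MeasurableSpace Z]
    (π : OneWayProtocol X Y Z) (D : PMF (X × Y)) {b : ℕ} (hb : π.cost D ≤ b) {x : X}
    (hx : ∃ y, (x, y) ∈ D.support) (r : π.Pub) (a : π.PrivA) : (π.msg x r a).length ≤ b := by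
  have h : ((π.msg x r a).length : ℕ∞) ≤ π.cost D :=
    le_iSup₂_of_le x hx (le_iSup₂_of_le r a le_rfl)
  exact_mod_cast h.trans hb

/-- If short messages force a large error, then the communication complexity is large. -/
theorem le_commComplexity {X Y Z : Type} [MeasurableSpace Z] [Countable (X × Y)]
    (P : X → Y → Z → Prop) (D : PMF (X × Y)) {δ : ℝ} {B : ℝ≥0∞} {c : ℝ≥0∞}
    (hc : ENNReal.ofReal δ < c)
    (h : ∀ b : ℕ, (b : ℝ≥0∞) < B → ∀ f : X → List Bool,
      (∀ x, (∃ y, (x, y) ∈ D.support) → (f x).length ≤ b) → ∀ g : List Bool → Y → Z,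
      c ≤ ∑' z : X × Y, D z * (open Classical in if P z.1 z.2 (g (f z.1) z.2) then 0 else 1)) :
    B ≤ ((commComplexity P D δ : ℕ∞) : ℝ≥0∞) := by
  by_contra hlt
  rw [not_le] at hlt
  have h1 : ∃ π : OneWayProtocol X Y Z, π.error P D ≤ ENNReal.ofReal δ ∧
      ((π.cost D : ℕ∞) : ℝ≥0∞) < B := by
    by_contra hcon
    push Not at hcon
    refine absurd hlt (not_lt.2 ?_)
    rcases eq_or_ne (commComplexity P D δ) ⊤ with htop | htop
    · simp [htop]
    · obtain ⟨b, hb⟩ := ENat.ne_top_iff_exists.1 htop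
      by_contra hlt'
      rw [not_le] at hlt'
      -- Costs are integers: if no admissible protocol costs less than `B` > b, all cost at least b
      -- + 1, and so does the infimum, which equals b.
      have h2 : ((b + 1 : ℕ) : ℕ∞) ≤ commComplexity P D δ := by
        refine le_iInf₂ fun π hπ => ?_
        by_contra h3
        have h4 : π.cost D ≤ b := by
          have : π.cost D < (b : ℕ∞) + 1 := by exact_mod_cast not_le.1 h3
          exact Order.le_of_lt_add_one this
        have h5 := hcon π hπ
        have h6 := h5.trans (ENat.toENNReal_le.2 h4)
        rw [hb] at h6
        exact absurd hlt' (not_lt.2 h6)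
      rw [← hb] at h2
      have : b + 1 ≤ b := by exact_mod_cast h2
      omega
  obtain ⟨π, hπ, hcost⟩ := h1
  have htop : π.cost D ≠ ⊤ := by
    rintro h
    simp [h] at hcost
  obtain ⟨b, hb⟩ := ENat.ne_top_iff_exists.1 htop
  rw [← hb] at hcost
  have h2 := π.le_error P D c fun r a b' =>
    h b (by simpa using hcost) (fun x => π.msg x r a)
      (fun x hx => π.length_msg_le D hb.ge hx r a) (fun w y => π.out w y r b')
  exact absurd (h2.trans hπ) (not_le.2 hc)

/-- The lower bound, given numerical estimates. -/
theorem le_commComplexity_setCoverEst {n m s p q : ℕ} (h : EstParams n m s p) (hp : 0 < p)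
    (hq0 : 0 < q) (hq : p * q ≤ s) (hn : s + p * q ≤ n) {α : ℝ} (hα : 0 ≤ α) {l δ B : ℝ}
    (hl : 0 < l)
    (hδ : max δ 0 < 1 / 2 - ((m : ℝ) ^ ⌊2 * α⌋₊ * ((⌊2 * α⌋₊ * s : ℝ) / n) ^ p +
        ((B + 1) * Real.log 2 / (l * (m * q)) + l / 2)) / 2) :
    ENNReal.ofReal B ≤
        ((commComplexity (SetCoverEst n m α) (distEst n m s p h) δ : ℕ∞) : ℝ≥0∞) ∧
      ENNReal.ofReal B ≤
        ((commComplexity (SetCoverEstIdx n m α) (distEstIdx n m s p h) δ : ℕ∞) : ℝ≥0∞) := by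
  set c := 1 / 2 - ((m : ℝ) ^ ⌊2 * α⌋₊ * ((⌊2 * α⌋₊ * s : ℝ) / n) ^ p +
        ((B + 1) * Real.log 2 / (l * (m * q)) + l / 2)) / 2 with hc
  have hlt : ENNReal.ofReal δ < ENNReal.ofReal c :=
    (ENNReal.ofReal_lt_ofReal_iff ((le_max_right _ _).trans_lt hδ)).2
      ((le_max_left _ _).trans_lt hδ)
  have hm : (0 : ℝ) < m := by exact_mod_cast h.m_pos
  have hq' : (0 : ℝ) < q := by exact_mod_cast hq0
  have key : ∀ b : ℕ, (b : ℝ≥0∞) < ENNReal.ofReal B → ∀ f : (Fin m → Finset (Fin n)) → List Bool,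
      (∀ S : Fin m → SizedSet n s, (f fun j => (S j).1).length ≤ b) →
      ∀ g : List Bool → Finset (Fin n) × Fin m → ℝ≥0∞,
      ENNReal.ofReal c ≤ ∑' z, distEstIdx n m s p h z *
        (open Classical in if SetCoverEstIdx n m α z.1 z.2 (g (f z.1) z.2) then 0 else 1) := by
    intro b hb f hf g
    refine le_trans (ENNReal.ofReal_le_ofReal ?_)
      (deterministic_error_ge h hp hq0 hq hn hα f hf g hl)
    have hbB : (b : ℝ) ≤ B := by
      have h1 : ENNReal.ofReal (b : ℝ) < ENNReal.ofReal B := by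
        rwa [ENNReal.ofReal_natCast]
      exact (ENNReal.ofReal_lt_ofReal_iff_of_nonneg (Nat.cast_nonneg b)).1 h1 |>.le
    rw [hc]
    have := Real.log_pos one_lt_two
    gcongr
  constructor
  -- Without the index, Bob's strategy is one that ignores it, so the estimate with the index
  -- revealed applies.
  · refine le_commComplexity _ _ hlt fun b hb f hf g => ?_
    refine (key b hb f (fun S => hf _ (exists_mem_support_distEst h S))
      (fun w y => g w y.1)).trans_eq ?_
    rw [distEst, PMF.tsum_map_mul]
    rfl
  · exact le_commComplexity _ _ hlt fun b hb f hf g =>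
      key b hb f (fun S => hf _ (exists_mem_support_distEstIdx h S)) g

/-! ### Numerical estimates for the parameters -/

/-- The sizes of the sets in the hard distribution. -/
structure SizeBounds (n m s p : ℕ) (α : ℝ) : Prop where
  one_le : 1 ≤ α
  one_le_logb : 1 ≤ Real.logb 2 m
  s_near : |(s : ℝ) - n / (10 * α)| < 1
  p_near : |(p : ℝ) - α * Real.logb 2 m| < 1
  n_large : 200 * (α ^ 2 * Real.logb 2 m) ≤ n

namespace SizeBounds

variable {n m s p : ℕ} {α : ℝ}

theorem m_pos (h : SizeBounds n m s p α) : 0 < m := by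
  rcases Nat.eq_zero_or_pos m with h0 | h0
  · have h1 := h.one_le_logb
    rw [h0] at h1
    norm_num at h1
  · exact h0

theorem n_ge (h : SizeBounds n m s p α) : 200 * α ≤ n := by
  nlinarith [h.one_le, h.one_le_logb, h.n_large, mul_nonneg (sub_nonneg.2 h.one_le)
    (zero_le_one.trans h.one_le), mul_nonneg (sq_nonneg α) (sub_nonneg.2 h.one_le_logb)]

theorem p_pos (h : SizeBounds n m s p α) : 0 < p := by
  have h1 := (abs_lt.1 h.p_near).1
  have h2 : 1 ≤ α * Real.logb 2 m := one_le_mul_of_one_le_of_one_le h.one_le h.one_le_logb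
  have : (0 : ℝ) < p := by linarith
  exact_mod_cast this

theorem p_upper (h : SizeBounds n m s p α) : (p : ℝ) ≤ 2 * (α * Real.logb 2 m) := by
  have h1 := (abs_lt.1 h.p_near).2
  have h2 : 1 ≤ α * Real.logb 2 m := one_le_mul_of_one_le_of_one_le h.one_le h.one_le_logb
  linarith

theorem s_lower (h : SizeBounds n m s p α) : n / (20 * α) ≤ (s : ℝ) := by
  have h1 := (abs_lt.1 h.s_near).1
  have hα : 0 < α := zero_lt_one.trans_le h.one_le
  have h2 : (1 : ℝ) ≤ n / (20 * α) := by
    rw [le_div_iff₀ (by positivity)]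
    linarith [h.n_ge]
  have h3 : (n : ℝ) / (10 * α) = 2 * (n / (20 * α)) := by
    field_simp
    ring
  linarith

theorem p_le_s (h : SizeBounds n m s p α) : p ≤ s := by
  have hα : 0 < α := zero_lt_one.trans_le h.one_le
  have h1 : 2 * (α * Real.logb 2 m) ≤ n / (20 * α) := by
    rw [le_div_iff₀ (by positivity)]
    have h2 := h.n_large
    have h3 : 0 ≤ α ^ 2 * Real.logb 2 m :=
      mul_nonneg (sq_nonneg α) (zero_le_one.trans h.one_le_logb)
    nlinarith
  exact_mod_cast (h.p_upper.trans h1).trans h.s_lower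

theorem two_mul_s_le (h : SizeBounds n m s p α) : 2 * s ≤ n := by
  have h1 := (abs_lt.1 h.s_near).2
  have hn := h.n_ge
  have hα := h.one_le
  have h2 : (n : ℝ) / (10 * α) ≤ n / 10 := by
    gcongr
    linarith
  have h3 : 2 * (s : ℝ) ≤ n := by linarith
  exact_mod_cast h3

theorem estParams (h : SizeBounds n m s p α) : EstParams n m s p := by
  have h1 := h.p_le_s
  have h2 := h.two_mul_s_le
  exact ⟨h.m_pos, h1, by omega⟩

theorem div_lower (h : SizeBounds n m s p α) :
    (n : ℝ) / (80 * (α ^ 2 * Real.logb 2 m)) ≤ (s / p : ℕ) := by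
  have hα : 0 < α := zero_lt_one.trans_le h.one_le
  have hL : 0 < Real.logb 2 m := zero_lt_one.trans_le h.one_le_logb
  have hq : 1 ≤ s / p := Nat.div_pos h.p_le_s h.p_pos
  -- As p ≤ s, the quotient is at least 1 and rounding it down loses at most a factor 2.
  have h1 : s ≤ 2 * (p * (s / p)) := by
    have h2 := Nat.lt_mul_div_succ s h.p_pos
    have h3 : p * 1 ≤ p * (s / p) := Nat.mul_le_mul_left p hq
    rw [mul_add] at h2
    omega
  have h2 : (s : ℝ) ≤ 2 * (p * (s / p : ℕ)) := by exact_mod_cast h1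
  have h3 : (p : ℝ) * (s / p : ℕ) ≤ 2 * (α * Real.logb 2 m) * (s / p : ℕ) :=
    mul_le_mul_of_nonneg_right h.p_upper (Nat.cast_nonneg _)
  have h4 := h.s_lower
  rw [div_le_iff₀ (by positivity)] at h4 ⊢
  nlinarith

/-- The choice of sets costs m^{2α} = 4^{αL} with L = log₂ m, and each point gains a factor 2αs/n,
which is about 1/5 and at most 2/9 after rounding s. Since 4 · 2/9 < 1, the product decays; 9/2 pays
for p ≥ αL − 1. -/
theorem cover_le (h : SizeBounds n m s p α) :
    (m : ℝ) ^ ⌊2 * α⌋₊ * ((⌊2 * α⌋₊ * s : ℝ) / n) ^ p ≤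
      9 / 2 * (8 / 9 : ℝ) ^ Real.logb 2 m := by
  set L := Real.logb 2 m with hL
  have hα1 := h.one_le
  have hL1 := h.one_le_logb
  rw [← hL] at hL1
  have hα : 0 < α := zero_lt_one.trans_le hα1
  have hm : (1 : ℝ) ≤ m := by exact_mod_cast h.m_pos
  have hn := h.n_ge
  have hn0 : (0 : ℝ) < n := by linarith
  have hfloor : ((⌊2 * α⌋₊ : ℕ) : ℝ) ≤ 2 * α := Nat.floor_le (by positivity)
  have h1 : (m : ℝ) ^ ⌊2 * α⌋₊ ≤ (4 : ℝ) ^ (α * L) := by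
    calc (m : ℝ) ^ ⌊2 * α⌋₊ = (m : ℝ) ^ ((⌊2 * α⌋₊ : ℕ) : ℝ) := (Real.rpow_natCast _ _).symm
      _ ≤ (m : ℝ) ^ (2 * α) := Real.rpow_le_rpow_of_exponent_le hm hfloor
      _ = ((2 : ℝ) ^ L) ^ (2 * α) := by
          rw [hL, Real.rpow_logb (by norm_num) (by norm_num) (by linarith)]
      _ = (4 : ℝ) ^ (α * L) := by
          rw [← Real.rpow_mul (by norm_num), show L * (2 * α) = 2 * (α * L) by ring,
            Real.rpow_mul (by norm_num)]
          norm_num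
  have h2 : (⌊2 * α⌋₊ * s : ℝ) / n ≤ 2 / 9 := by
    rw [div_le_iff₀ hn0]
    have hs : (s : ℝ) ≤ n / (10 * α) + 1 := by linarith [(abs_lt.1 h.s_near).2]
    calc (⌊2 * α⌋₊ * s : ℝ) ≤ 2 * α * (n / (10 * α) + 1) := by gcongr
      _ = n / 5 + 2 * α := by
          field_simp
          ring
      _ ≤ 2 / 9 * n := by linarith
  have h3 : ((⌊2 * α⌋₊ * s : ℝ) / n) ^ p ≤ (2 / 9 : ℝ) ^ (α * L - 1) := by
    calc ((⌊2 * α⌋₊ * s : ℝ) / n) ^ p ≤ (2 / 9 : ℝ) ^ p := by gcongr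
      _ = (2 / 9 : ℝ) ^ (p : ℝ) := (Real.rpow_natCast _ _).symm
      _ ≤ (2 / 9 : ℝ) ^ (α * L - 1) :=
          Real.rpow_le_rpow_of_exponent_ge (by norm_num) (by norm_num)
            (by linarith [(abs_lt.1 h.p_near).1])
  calc (m : ℝ) ^ ⌊2 * α⌋₊ * ((⌊2 * α⌋₊ * s : ℝ) / n) ^ p
      ≤ (4 : ℝ) ^ (α * L) * (2 / 9 : ℝ) ^ (α * L - 1) := by gcongr
    _ = 9 / 2 * (8 / 9 : ℝ) ^ (α * L) := by
        rw [Real.rpow_sub (by norm_num), Real.rpow_one, show (8 / 9 : ℝ) = 4 * (2 / 9) by norm_num,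
          Real.mul_rpow (by norm_num) (by norm_num)]
        ring
    _ ≤ 9 / 2 * (8 / 9 : ℝ) ^ L := by
        have : (8 / 9 : ℝ) ^ (α * L) ≤ (8 / 9 : ℝ) ^ L :=
          Real.rpow_le_rpow_of_exponent_ge (by norm_num) (by norm_num) (by nlinarith)
        linarith

/-- The lower bound at a fixed size of the universe. -/
theorem le_commComplexity (h : SizeBounds n m s p α) {δ γ B : ℝ} (hγ : 0 < γ)
    (hδ : max δ 0 = 1 / 2 - γ) (hcover : 9 / 2 * (8 / 9 : ℝ) ^ Real.logb 2 m < γ / 2)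
    (hm : 2 ≤ γ ^ 2 * m)
    (hB : B ≤ γ ^ 2 / 160 * (m * n / (α ^ 2 * Real.logb 2 m))) :
    ENNReal.ofReal B ≤ ((commComplexity (SetCoverEst n m α)
        (distEst n m s p h.estParams) δ : ℕ∞) : ℝ≥0∞) ∧
      ENNReal.ofReal B ≤ ((commComplexity (SetCoverEstIdx n m α)
        (distEstIdx n m s p h.estParams) δ : ℕ∞) : ℝ≥0∞) := by
  have hq : 0 < s / p := Nat.div_pos h.p_le_s h.p_pos
  have hpq : p * (s / p) ≤ s := Nat.mul_div_le s p
  have h2s := h.two_mul_s_le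
  -- The choice l = γ: the cover term is below γ/2, the message term at most γ and l/2 = γ/2, so
  -- half of their sum is below γ.
  refine le_commComplexity_setCoverEst h.estParams h.p_pos hq hpq (by omega)
    (zero_le_one.trans h.one_le) hγ ?_
  have hα : 0 < α := zero_lt_one.trans_le h.one_le
  have hL : 0 < Real.logb 2 m := zero_lt_one.trans_le h.one_le_logb
  have hm0 : (0 : ℝ) < m := by exact_mod_cast h.m_pos
  have hq1 : (1 : ℝ) ≤ (s / p : ℕ) := by exact_mod_cast hq
  have h1 := h.cover_le
  -- Half of the right side bounds `B` through the lower bound on q, the other half absorbs the 1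
  -- because γ²m ≥ 2.
  have h2 : B + 1 ≤ γ ^ 2 * (m * (s / p : ℕ)) := by
    have h3 : (m : ℝ) ≤ m * (s / p : ℕ) := le_mul_of_one_le_right hm0.le hq1
    have h4 : (m : ℝ) * n / (α ^ 2 * Real.logb 2 m) ≤ 80 * (m * (s / p : ℕ)) := by
      have h5 := mul_le_mul_of_nonneg_left h.div_lower hm0.le
      have h6 : (m : ℝ) * (n / (80 * (α ^ 2 * Real.logb 2 m))) =
          m * n / (α ^ 2 * Real.logb 2 m) / 80 := by
        field_simp
      linarith
    have h5 := mul_le_mul_of_nonneg_left h4 (by positivity : 0 ≤ γ ^ 2 / 160)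
    have h6 := mul_le_mul_of_nonneg_left h3 (by positivity : 0 ≤ γ ^ 2)
    linarith
  have h3 : (B + 1) * Real.log 2 / (γ * (m * (s / p : ℕ))) ≤ γ := by
    rw [div_le_iff₀ (by positivity)]
    have hlog : Real.log 2 ≤ 1 := by linarith [Real.log_two_lt_d9]
    have hlog0 : 0 ≤ Real.log 2 := Real.log_nonneg one_le_two
    calc (B + 1) * Real.log 2 ≤ γ ^ 2 * (m * (s / p : ℕ)) * Real.log 2 := by gcongr
      _ ≤ γ ^ 2 * (m * (s / p : ℕ)) * 1 := by gcongr
      _ = γ * (γ * (m * (s / p : ℕ))) := by ring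
  rw [hδ]
  linarith

end SizeBounds

/-! ### Asymptotics -/

theorem logb_two_le_of_le_pow {n m C : ℕ} (hm : 0 < m) (h : m ≤ n ^ C) :
    Real.logb 2 m ≤ 2 * (C + 1) * Real.log n := by
  have hm' : (0 : ℝ) < m := by exact_mod_cast hm
  have h' : (m : ℝ) ≤ (n : ℝ) ^ C := by exact_mod_cast h
  have h1 : Real.log m ≤ C * Real.log n := by
    rw [← Real.log_pow]
    exact Real.log_le_log hm' h'
  have hn0 : 0 ≤ Real.log n := Real.log_natCast_nonneg n
  have h2 : (1 / 2 : ℝ) ≤ Real.log 2 := by linarith [Real.log_two_gt_d9]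
  rw [Real.logb, div_le_iff₀ (by linarith)]
  have h3 : (0 : ℝ) ≤ 2 * (C + 1) * Real.log n := by positivity
  nlinarith

theorem mainTheorem6 (δ : ℝ) (hδ : δ < 1 / 2) (C : ℕ) :
    ∃ c : ℝ, 0 < c ∧ ∃ k : ℕ,
      ∀ (m s p : ℕ → ℕ) (α : ℕ → ℝ),
        Tendsto m atTop atTop →
        (∀ᶠ n in atTop, m n ≤ n ^ C) →
        (∀ᶠ n in atTop, 1 ≤ α n) →
        (α =o[atTop] fun n : ℕ => Real.sqrt ((n : ℝ) / Real.log (n : ℝ))) →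
        (∀ᶠ n in atTop, |(s n : ℝ) - (n : ℝ) / (10 * α n)| < 1) →
        (∀ᶠ n in atTop, |(p n : ℝ) - α n * Real.logb 2 (m n : ℝ)| < 1) →
        ∀ᶠ n in atTop, ∃ h : EstParams n (m n) (s n) (p n),
          ENNReal.ofReal (c * ((m n : ℝ) * (n : ℝ) / (α n) ^ 2) / (Real.log (n : ℝ)) ^ k) ≤
              ((commComplexity (SetCoverEst n (m n) (α n))
                (distEst n (m n) (s n) (p n) h) δ : ℕ∞) : ℝ≥0∞) ∧
          ENNReal.ofReal (c * ((m n : ℝ) * (n : ℝ) / (α n) ^ 2) / (Real.log (n : ℝ)) ^ k) ≤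
              ((commComplexity (SetCoverEstIdx n (m n) (α n))
                (distEstIdx n (m n) (s n) (p n) h) δ : ℕ∞) : ℝ≥0∞) := by
  -- γ is the gap between the allowed error and 1/2; a negative δ counts as error 0.
  obtain ⟨γ, hγ⟩ : ∃ γ : ℝ, max δ 0 = 1 / 2 - γ := ⟨1 / 2 - max δ 0, by ring⟩
  have hγ0 : 0 < γ := by
    have : max δ 0 < 1 / 2 := max_lt hδ (by norm_num)
    linarith
  -- The constant is γ²/160 divided by the 2(C + 1) of log₂ m ≤ 2(C + 1) log n; this is the only
  -- logarithm lost, so k = 1.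
  refine ⟨γ ^ 2 / (320 * (C + 1)), by positivity, 1, ?_⟩
  intro m s p α hm hmC hα1 hα hs hp
  have hmR : Tendsto (fun n => (m n : ℝ)) atTop atTop := tendsto_natCast_atTop_atTop.comp hm
  have hL : Tendsto (fun n => Real.logb 2 (m n : ℝ)) atTop atTop :=
    (Real.tendsto_logb_atTop one_lt_two).comp hmR
  have hcover : ∀ᶠ n in atTop, 9 / 2 * (8 / 9 : ℝ) ^ Real.logb 2 (m n : ℝ) < γ / 2 := by
    have h1 : Tendsto (fun n => 9 / 2 * (8 / 9 : ℝ) ^ Real.logb 2 (m n : ℝ)) atTop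
        (nhds (9 / 2 * 0)) :=
      ((tendsto_rpow_atTop_of_base_lt_one (8 / 9 : ℝ) (by norm_num) (by norm_num)).comp
        hL).const_mul _
    rw [mul_zero] at h1
    exact h1.eventually_lt_const (by positivity)
  have hmγ : ∀ᶠ n in atTop, 2 ≤ γ ^ 2 * m n :=
    (hmR.const_mul_atTop (by positivity : 0 < γ ^ 2)).eventually_ge_atTop 2
  -- Squaring the bound on α with this constant gives 400(C + 1) α² log n ≤ n, hence 200 α² log₂ m ≤
  -- n.
  have hε : (0 : ℝ) < Real.sqrt (1 / (400 * (C + 1))) := Real.sqrt_pos.2 (by positivity)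
  filter_upwards [hcover, hmγ, hmC, hα1, hα.bound hε, hs, hp, hL.eventually_ge_atTop 1,
    eventually_ge_atTop 3] with n hcover hmγ hmC hα1 hα hs hp hL hn
  have hn' : (0 : ℝ) < n := by
    exact_mod_cast (by omega : 0 < n)
  have hlog : 0 < Real.log n := Real.log_pos (by exact_mod_cast (by omega : 1 < n))
  have hm0 : (0 : ℝ) < m n := by
    by_contra hneg
    have : (m n : ℝ) = 0 := le_antisymm (not_lt.1 hneg) (Nat.cast_nonneg _)
    rw [this] at hL
    norm_num at hL
  have hLC := logb_two_le_of_le_pow (by exact_mod_cast hm0) hmC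
  have hα2 : α n ^ 2 * (400 * (C + 1) * Real.log n) ≤ n := by
    have h1 : α n ≤ Real.sqrt (1 / (400 * (C + 1)) * (n / Real.log n)) := by
      rw [Real.sqrt_mul (by positivity)]
      refine (Real.le_norm_self _).trans (hα.trans_eq ?_)
      rw [Real.norm_of_nonneg (Real.sqrt_nonneg _)]
    have h2 := (Real.le_sqrt (by linarith) (by positivity)).1 h1
    have h3 : 1 / (400 * (C + 1)) * (n / Real.log n) = n / (400 * (C + 1 : ℝ) * Real.log n) := by
      field_simp
    rwa [h3, le_div_iff₀ (by positivity)] at h2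
  have h : SizeBounds n (m n) (s n) (p n) (α n) := by
    refine ⟨hα1, hL, hs, hp, le_trans ?_ hα2⟩
    have := mul_le_mul_of_nonneg_left hLC (sq_nonneg (α n))
    linarith
  refine ⟨h.estParams, h.le_commComplexity hγ0 hγ hcover hmγ ?_⟩
  have hα0 : 0 < α n := by linarith
  calc γ ^ 2 / (320 * (C + 1)) * ((m n : ℝ) * n / α n ^ 2) / Real.log n ^ 1
      = γ ^ 2 / 160 * ((m n : ℝ) * n / (α n ^ 2 * (2 * (C + 1) * Real.log n))) := by
        field_simp
        norm_num
    _ ≤ γ ^ 2 / 160 * ((m n : ℝ) * n / (α n ^ 2 * Real.logb 2 (m n : ℝ))) := by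
        gcongr
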